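/- **Setting.** A *data-tuple* has an event type and a partial map from attribute names to data values; a *predicate* is a set of data-tuples; a *stream* $S=t_0t_1t_2\dots$ is a finite or infinite sequence of data-tuples. A *complex event* is $C=([i,j],D)$ with $i\le j$ in $\mathbb N$ and $D\subseteq\{i,\dots,j\}$; put $|C|=|D|+2$. A *complex event automaton* (CEA) $\mathcal A=(Q,\Delta,q_0,F)$ has a finite state set $Q$, a finite set $\Delta\subseteq Q\times\{\text{predicates}\}\times\{\bullet,\circ\}\times(Q\setminus\{q_0\})$ of marking ($\bullet$) and unmarking ($\circ$) transitions, an initial state $q_0$ and final states $F\subseteq Q$. It is *I/O-deterministic* if any two distinct transitions from the same state whose predicates intersect have different actions. A *run* over $S$ from $i$ to $j$ ($i\le j$) is a sequence of consecutive transitions, starting in $q_0$ and reading $t_i,\dots,t_j$, each tuple satisfying the predicate of its transition; it is accepting if it ends in $F$, and its complex event is $([i,j],D)$ with $D$ the set of positions read by marking transitions. Let $[\![\mathcal A]\!]^\epsilon_j(S)$ be the set of complex events $([i,j],D)$ of accepting runs that end at position $j$ and satisfy $j-i\le\epsilon$ ($\epsilon\in\mathbb N$). **Data structure.** A *tECS*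 is a directed acyclic graph whose nodes are bottom nodes (labelled by a position, no child), output nodes (labelled by a position, one child) and union nodes (a left and a right child), each also storing a number $\max(n)$. A *full-path* from a node $n$ is a path from $n$ to a bottom node; it represents the open complex event $(i,D)$, where $i$ is the label of the bottom node and $D$ the set of labels of the output nodes on it. The *maximum-start* of $n$ is the largest $i$ over all full-paths from $n$. The tECS is *time-ordered* if every $\max(n)$ is the maximum-start of $n$ and, at every union node, the maximum-start of the left child is at least that of the right child; the *output-depth* of a node is the number of union nodes met when going left until a non-union node is reached, and the tECS is *$k$-bounded* if all output-depths are at most $k$; it is *duplicate-free* if distinct full-paths from the same node represent distinct open complex events. A node is *safe* if it is a non-union node, or it has output-depth $1$ and its right child has output-depth at most $2$. A *union-list* is a non-empty sequence $n_0,\dots,n_k$ of safe nodes with $n_0$ a non-union node of largest maximum-start and $n_1,\dots,n_k$ of strictly decreasing maximum-starts. *Methods.* $\mathrm{bottom}(i)$ and $\mathrm{extend}(n,j)$ create a bottom node labelled $i$ and an output node labelled $j$ with child $n$. Write $(l\vee r)$ for a new union node with left child $l$, right child $r$. $\mathrm{union}(n_1,n_2)$ is $(n_1\vee n_2)$ if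 $n_1$ is non-union; otherwise $(n_2\vee n_1)$ if $n_2$ is non-union; otherwise, with $l_i,r_i$ the children of $n_i$, it is $(l_1\vee(l_2\vee(r_1\vee r_2)))$ if $\max(r_1)\ge\max(r_2)$ and $(l_1\vee(l_2\vee(r_2\vee r_1)))$ if not. $\mathrm{init}(n)$ is the list $n$. $\mathrm{insert}(U,n)$ (legal only if $\max(n)\le\max(n_0)$) replaces the $n_i$, $i\ge1$, with $\max(n_i)=\max(n)$ by $\mathrm{union}(n_i,n)$ if there is one, and otherwise inserts $n$ among $n_1,\dots,n_k$ at the place given by the order. $\mathrm{merge}(U)$ is $(n_0\vee(n_1\vee(\cdots\vee n_k)))$, and $n_0$ if $k=0$. **Algorithm.** The algorithm keeps a tECS and a hash table $T$ (initially empty) from states to union-lists. Iteration $j=0,1,2,\dots$ reads $t_j$ and (i) *updates*: it starts an empty table $T'$, calls $\mathrm{ExecTrans}(q_0,\mathrm{init}(\mathrm{bottom}(j)))$ and then $\mathrm{ExecTrans}(p,T[p])$ for all keys $p$ of $T$ in order of their first insertion, and sets $T:=T'$. Here $\mathrm{ExecTrans}(p,U)$ computes $n:=\mathrm{merge}(U)$;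 if a marking transition from $p$ to some $q$ reads $t_j$, it computes $n':=\mathrm{extend}(n,j)$ and calls $\mathrm{Add}(q,n',\mathrm{init}(n'))$; then, if an unmarking transition from $p$ to some $q$ reads $t_j$, it calls $\mathrm{Add}(q,n,U)$. $\mathrm{Add}(q,n,U)$ sets $T'[q]:=\mathrm{insert}(T'[q],n)$ if $q$ is a key of $T'$, and $T'[q]:=U$ otherwise. (ii) calls *Output*: for every key $p\in F$ of $T$ it computes $n:=\mathrm{merge}(T[p])$ and runs $\mathrm{Enumerate}(n)$, a depth-first search from $n$ with an explicit stack, started only if $\max(n)\ge j-\epsilon$, that collects the labels $P$ of the output nodes on the current path, goes left before right at a union node, visits a right child $r$ only if $\max(r)\ge j-\epsilon$, and prints $([i,j],P)$ at a bottom node labelled $i$. Time is counted on a unit-cost RAM on which memory accesses, hash table look-ups and insertions, and evaluations of a predicate on a tuple take one step, and printing $C$ takes $|C|$ steps. **Theorem.** There is an absolute constant $c$ such that for every I/O-deterministic CEA $\mathcal A=(Q,\Delta,q_0,F)$, every stream $S$, every $\epsilon\in\mathbb N$ and every position $j$ of $S$, the algorithm completes iteration $j$ (every call of $\mathrm{insert}$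 being legal), and: 1. The call of Output in iteration $j$ prints exactly the elements of $[\![\mathcal A]\!]^\epsilon_j(S)$, each once, with output-linear delay: each printed event $C$ is printed within $c\,(|Q|^2+|C|)$ steps of the previous one (of the start of Output, if it is the first), and Output ends within $c\,|Q|^2$ steps of the last one (of its start, if there is none). The update prints nothing. 2. After the update and after Output, the tECS is a directed acyclic graph and is time-ordered, $3$-bounded and duplicate-free. 3. After the update, every $T[q]$ is a union-list (in particular sorted by maximum-start) of length at most $|Q|+1$, and along the insertion order of the keys of $T$ the maximum-starts of the first nodes of the lists do not increase. 4. The update takes at most $c\,(|Q|\cdot|\Delta|+1)$ steps; so the update time is $O(|Q|\cdot|\Delta|)$ (if $\Delta\neq\emptyset$), and constant in data complexity. -/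

import Mathlib

universe u v w

namespace CER

/-! ### Events, streams, complex events -/

/-- A data-tuple: an event type together with a partial map from attribute names to data values
(`attr a = none` means that the attribute `a` is undefined). -/
structure DataTuple (Ty Attr Val : Type*) where
  type : Ty
  attr : Attr → Option Val

/-- A complex event `([start, finish], data)` with `start ≤ finish` and
`data ⊆ {start, …, finish}`. -/
structure ComplexEvent where
  start : ℕ
  finish : ℕ
  data : Finset ℕ
  le : start ≤ finish
  sub : data ⊆ Finset.Icc start finish

/-- The size of a complex event: its marked positions and the two end points of its interval. -/
def ComplexEvent.size (C : ComplexEvent) : ℕ := C.data.card + 2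

/-! ### Complex event automata -/

/-- The two actions of a transition: marking and unmarking. -/
inductive Action where
  | mark
  | unmark
  deriving DecidableEq

/-- A transition `source --pred/action--> target`; a predicate is a set of data-tuples. -/
structure Transition (Tup : Type*) (Q : Type) where
  source : Q
  pred : Set Tup
  action : Action
  target : Q

/-- A complex event automaton with state space `Q`; no transition enters the initial state. -/
structure CEA (Tup : Type*) (Q : Type) where
  Δ : Finset (Transition Tup Q)
  q₀ : Q
  F : Finset Q
  target_ne : ∀ e ∈ Δ, e.target ≠ q₀

namespace CEA

variable {Tup : Type*} {Q : Type}

/-- Two different transitions from the same state that can be triggered by the same tuple have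
different actions. -/
def IODeterministic (A : CEA Tup Q) : Prop :=
  ∀ e₁ ∈ A.Δ, ∀ e₂ ∈ A.Δ, e₁ ≠ e₂ → e₁.source = e₂.source →
    (e₁.pred ∩ e₂.pred).Nonempty → e₁.action ≠ e₂.action

/-- `ρ i, ρ (i+1), …, ρ j` is a run of `A` over the (finite or infinite) stream `S` from position
`i` to position `j`. The values of `ρ` outside `[i, j]` play no role. -/
structure IsRun (A : CEA Tup Q) (S : Stream'.Seq Tup) (i j : ℕ) (ρ : ℕ → Transition Tup Q) :
    Prop where
  le : i ≤ j
  init : (ρ i).source = A.q₀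
  step : ∀ k ∈ Finset.Icc i j, ρ k ∈ A.Δ ∧ ∃ t, S.get? k = some t ∧ t ∈ (ρ k).pred
  link : ∀ k ∈ Finset.Ico i j, (ρ k).target = (ρ (k + 1)).source

/-- The complex event `([i, j], {k ∈ [i, j] | the k-th action is marking})` of a run. -/
def complexEvent (ρ : ℕ → Transition Tup Q) (i j : ℕ) (h : i ≤ j) : ComplexEvent where
  start := i
  finish := j
  data := (Finset.Icc i j).filter fun k => (ρ k).action = Action.mark
  le := h
  sub := Finset.filter_subset _ _

/-- The complex events of all accepting runs of `A` over `S`. -/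
def sem (A : CEA Tup Q) (S : Stream'.Seq Tup) : Set ComplexEvent :=
  {C | ∃ (i j : ℕ) (ρ : ℕ → Transition Tup Q) (h : A.IsRun S i j ρ),
    (ρ j).target ∈ A.F ∧ C = complexEvent ρ i j h.le}

/-- The complex events of accepting runs that end at position `j` and span at most `ε`. -/
def semAt (A : CEA Tup Q) (S : Stream'.Seq Tup) (ε j : ℕ) : Set ComplexEvent :=
  {C | C ∈ A.sem S ∧ C.finish - C.start ≤ ε ∧ C.finish = j}

end CEA

/-! ### Timed enumerable compact sets (tECS)

A tECS is stored in an append-only memory; a node is the address of its cell. Every cell carries a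
label `max` besides its position label and its pointers. -/

abbrev NodeId := ℕ

inductive Cell where
  | bottom (pos max : ℕ)
  | output (pos : ℕ) (next : NodeId) (max : ℕ)
  | union (left right : NodeId) (max : ℕ)

def Cell.max : Cell → ℕ
  | .bottom _ m => m
  | .output _ _ m => m
  | .union _ _ m => m

abbrev TECS := Array Cell

namespace TECS

/-- The edges of the graph. -/
inductive Child (E : TECS) : NodeId → NodeId → Prop where
  | next {n p m x : ℕ} : E[n]? = some (Cell.output p m x) → Child E n m
  | left {n l r x : ℕ} : E[n]? = some (Cell.union l r x) → Child E n l
  | right {n l r x : ℕ} : E[n]? = some (Cell.union l r x) → Child E n r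

/-- All pointers point to nodes of `E`, and the graph is acyclic. -/
def IsDAG (E : TECS) : Prop :=
  (∀ n m, Child E n m → m < E.size) ∧ ∀ n, ¬ Relation.TransGen (Child E) n n

/-- `FullPath E n p i D`: the list of nodes `p` is a full-path (one that ends in a bottom node)
starting at `n`, and it represents the open complex event `(i, D)`: `i` is the label of the bottom
node, `D` is the set of labels of the other non-union nodes. -/
inductive FullPath (E : TECS) : NodeId → List NodeId → ℕ → Finset ℕ → Prop where
  | bottom {n i x : ℕ} : E[n]? = some (Cell.bottom i x) → FullPath E n [n] i ∅
  | output {n k m x : ℕ} {p : List NodeId} {i : ℕ} {D : Finset ℕ} :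
      E[n]? = some (Cell.output k m x) → FullPath E m p i D → FullPath E n (n :: p) i (insert k D)
  | left {n l r x : ℕ} {p : List NodeId} {i : ℕ} {D : Finset ℕ} :
      E[n]? = some (Cell.union l r x) → FullPath E l p i D → FullPath E n (n :: p) i D
  | right {n l r x : ℕ} {p : List NodeId} {i : ℕ} {D : Finset ℕ} :
      E[n]? = some (Cell.union l r x) → FullPath E r p i D → FullPath E n (n :: p) i D

/-- The set of open complex events represented by a node. -/
def openEvents (E : TECS) (n : NodeId) : Set (ℕ × Finset ℕ) :=
  {o | ∃ p, FullPath E n p o.1 o.2}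

/-- The start positions of the open complex events represented by a node. -/
def starts (E : TECS) (n : NodeId) : Set ℕ := {i | ∃ D, (i, D) ∈ openEvents E n}

/-- The maximum-start of a node. -/
noncomputable def maxStart (E : TECS) (n : NodeId) : ℕ := sSup (starts E n)

/-- Every node carries its maximum-start as a label (in particular the maximum exists), and at
union nodes the left child has at least the maximum-start of the right child. -/
def TimeOrdered (E : TECS) : Prop :=
  (∀ (n : NodeId) (c : Cell), E[n]? = some c → IsGreatest (starts E n) c.max) ∧
  ∀ (u l r : NodeId) (x : ℕ), E[u]? = some (Cell.union l r x) → maxStart E r ≤ maxStart E l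

def IsUnion (E : TECS) (n : NodeId) : Prop := ∃ l r x, E[n]? = some (Cell.union l r x)

/-- A bottom node or an output node of `E`. -/
def IsNonUnion (E : TECS) (n : NodeId) : Prop := n < E.size ∧ ¬ IsUnion E n

/-- `ODepth E n d`: the (left) output-depth of the node `n` is `d`. -/
inductive ODepth (E : TECS) : NodeId → ℕ → Prop where
  | zero {n : NodeId} : IsNonUnion E n → ODepth E n 0
  | succ {n l r x d : ℕ} : E[n]? = some (Cell.union l r x) → ODepth E l d → ODepth E n (d + 1)

/-- Every node has output-depth at most `k`. -/
def KBounded (k : ℕ) (E : TECS) : Prop := ∀ n, n < E.size → ∃ d ≤ k, ODepth E n d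

/-- Distinct full-paths from the same node represent distinct open complex events. -/
def DuplicateFree (E : TECS) : Prop :=
  ∀ n p p' i i' D D', FullPath E n p i D → FullPath E n p' i' D' → p ≠ p' → (i, D) ≠ (i', D')

/-- A node is safe if it is a non-union node, or it has output-depth `1` and its right child has
output-depth at most `2`. -/
def Safe (E : TECS) (n : NodeId) : Prop :=
  IsNonUnion E n ∨
    ∃ l r x, E[n]? = some (Cell.union l r x) ∧ ODepth E n 1 ∧ ∃ d ≤ 2, ODepth E r d

/-- `n₀, n₁, …, n_k` is a union-list: all nodes are safe, `n₀` is a non-union node of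
largest maximum-start, and `n₁, …, n_k` have strictly decreasing maximum-starts. -/
def IsUnionList (E : TECS) : List NodeId → Prop
  | [] => False
  | n₀ :: ns =>
      (∀ n ∈ n₀ :: ns, Safe E n) ∧ IsNonUnion E n₀ ∧
      (∀ n ∈ ns, maxStart E n ≤ maxStart E n₀) ∧
      ns.Pairwise fun a b => maxStart E b < maxStart E a

/-- The maximum-start of a non-empty union-list, that is, of its first node. -/
noncomputable def listMaxStart (E : TECS) (U : List NodeId) : ℕ := maxStart E (U.headD 0)

end TECS

/-! ### The machine

Programs run on a RAM with unit cost: a program is a state transformer that may fail (illegal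
memory access, call of a method outside of its preconditions, or divergence). A clock counts the
steps. Every memory access, allocation, hash table access, list or stack operation, transition
test and loop iteration advances the clock by one step, and printing a complex event advances it by
the size of what is printed; between two advances there are boundedly many further elementary
operations. -/

/-- A hash table from states to union-lists, as the list of its entries in the order in which the
keys were first inserted. Look-up and insertion are charged one step by the programs below. -/
abbrev Table (Q : Type) := List (Q × List NodeId)

section Table
variable {Q : Type} [DecidableEq Q]

def Table.find? : Table Q → Q → Option (List NodeId)
  | [], _ => none
  | (p, U) :: T, q => if p = q then some U else Table.find? T q

/-- Insert a new key at the end, or update the value of an old key in place. -/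
def Table.set : Table Q → Q → List NodeId → Table Q
  | [], q, V => [(q, V)]
  | (p, U) :: T, q, V => if p = q then (p, V) :: T else (p, U) :: Table.set T q V

end Table

structure Machine (Q : Type) where
  /-- the tECS -/
  ecs : TECS
  /-- the hash table `T` -/
  T : Table Q
  /-- the hash table `T'` -/
  T' : Table Q
  /-- the number of steps made so far -/
  clock : ℕ
  /-- the complex events printed so far, each with the time at which its printing was complete -/
  log : List (ComplexEvent × ℕ)

abbrev RAM (Q : Type) := StateT (Machine Q) Option

section Programs

variable {Tup : Type*} {Q : Type}

/-- Let `k` steps pass. -/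
def tick (k : ℕ := 1) : RAM Q Unit :=
  modify fun s => { s with clock := s.clock + k }

def readCell (n : NodeId) : RAM Q Cell := do
  tick
  let s ← get
  match s.ecs[n]? with
  | some c => pure c
  | none => failure

def readMax (n : NodeId) : RAM Q ℕ := do
  let c ← readCell n
  pure c.max

def alloc (c : Cell) : RAM Q NodeId := do
  tick
  let s ← get
  set { s with ecs := s.ecs.push c }
  pure s.ecs.size

/-! #### Methods of the tECS -/

def newBottom (i : ℕ) : RAM Q NodeId := alloc (.bottom i i)

def extend (n : NodeId) (j : ℕ) : RAM Q NodeId := do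
  let m ← readMax n
  alloc (.output j n m)

def newUnion (l r : NodeId) : RAM Q NodeId := do
  let ml ← readMax l
  let mr ← readMax r
  alloc (.union l r (max ml mr))

/-- The method `union`: a node that represents the open complex events of `n₁` and of `n₂`. -/
def union (n₁ n₂ : NodeId) : RAM Q NodeId := do
  let c₁ ← readCell n₁
  let c₂ ← readCell n₂
  match c₁, c₂ with
  | .union l₁ r₁ _, .union l₂ r₂ _ =>
      let m₁ ← readMax r₁
      let m₂ ← readMax r₂
      let u₂ ← if m₂ ≤ m₁ then newUnion r₁ r₂ else newUnion r₂ r₁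
      let u₁ ← newUnion l₂ u₂
      newUnion l₁ u₁
  | .union _ _ _, _ => newUnion n₂ n₁
  | _, _ => newUnion n₁ n₂

/-! #### Methods of union-lists -/

def listInit (n : NodeId) : RAM Q (List NodeId) := do
  tick
  pure [n]

/-- Insert the node `n` with label `m` into the tail `n₁, …, n_k` of a union-list. -/
def insertTail (n : NodeId) (m : ℕ) : List NodeId → RAM Q (List NodeId)
  | [] => do
      tick
      pure [n]
  | x :: xs => do
      let mx ← readMax x
      if mx = m then
        let u ← union x n
        pure (u :: xs)
      else if mx < m then
        pure (n :: x :: xs)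
      else
        let ys ← insertTail n m xs
        pure (x :: ys)

/-- The method `insert`; a call is illegal (fails) if the maximum-start of `n` exceeds the one of
the first node. -/
def listInsert : List NodeId → NodeId → RAM Q (List NodeId)
  | [], _ => failure
  | n₀ :: ns, n => do
      let m₀ ← readMax n₀
      let m ← readMax n
      if m ≤ m₀ then
        let ns' ← insertTail n m ns
        pure (n₀ :: ns')
      else failure

/-- The method `merge`: the node `n₀ ∨ (n₁ ∨ (⋯ ∨ n_k))`. -/
def listMerge : List NodeId → RAM Q NodeId
  | [] => failure
  | [n] => do
      tick
      pure n
  | n :: n' :: ns => do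
      tick
      let u ← listMerge (n' :: ns)
      newUnion n u

/-! #### The evaluation algorithm -/

open Classical in
/-- Scan a list of transitions for one from `p` with action `a` that can read `t`. -/
noncomputable def scan (p : Q) (t : Tup) (a : Action) :
    List (Transition Tup Q) → RAM Q (Option Q)
  | [] => do
      tick
      pure none
  | e :: es => do
      tick
      if e.source = p ∧ e.action = a ∧ t ∈ e.pred then pure (some e.target)
      else scan p t a es

/-- `q ← Δ(p, t, a)`. -/
noncomputable def delta (A : CEA Tup Q) (p : Q) (t : Tup) (a : Action) : RAM Q (Option Q) :=
  scan p t a A.Δ.toList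

variable [DecidableEq Q]

def add (q : Q) (n : NodeId) (U : List NodeId) : RAM Q Unit := do
  tick
  let s ← get
  match Table.find? s.T' q with
  | some V =>
      let V' ← listInsert V n
      tick
      modify fun s => { s with T' := Table.set s.T' q V' }
  | none =>
      tick
      modify fun s => { s with T' := Table.set s.T' q U }

noncomputable def execTrans (A : CEA Tup Q) (p : Q) (U : List NodeId) (t : Tup) (j : ℕ) :
    RAM Q Unit := do
  let n ← listMerge U
  match ← delta A p t Action.mark with
  | some q =>
      let n' ← extend n j
      let U' ← listInit n'
      add q n' U'
  | none => pure ()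
  match ← delta A p t Action.unmark with
  | some q => add q n U
  | none => pure ()

/-- Execute the transitions of all keys, in the given order. -/
noncomputable def execAll (A : CEA Tup Q) (t : Tup) (j : ℕ) : Table Q → RAM Q Unit
  | [] => tick
  | (p, U) :: T => do
      tick
      execTrans A p U t j
      execAll A t j T

/-- The part of the `j`-th iteration that reads the tuple `t` and updates the tECS and the hash
tables. -/
noncomputable def update (A : CEA Tup Q) (t : Tup) (j : ℕ) : RAM Q Unit := do
  tick
  modify fun s => { s with T' := [] }
  let b ← newBottom j
  let U ← listInit b
  execTrans A A.q₀ U t j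
  let s ← get
  execAll A t j s.T
  tick
  modify fun s => { s with T := s.T' }

/-- Print the complex event `([i, j], P)`; fails if this is no complex event. -/
def emit (i j : ℕ) (P : List ℕ) : RAM Q Unit := do
  tick (P.length + 2)
  if h : i ≤ j ∧ P.toFinset ⊆ Finset.Icc i j then
    modify fun s => { s with log := s.log ++ [(⟨i, j, P.toFinset, h.1, h.2⟩, s.clock)] }
  else failure

/-- The depth-first search of `Enumerate`, cut off (failing) after `k` rounds. The pair of the
current node and of the list of the positions that were collected on the way to it is kept on top of
the stack. -/
def enumRounds (τ j : ℕ) : ℕ → List (NodeId × List ℕ) → RAM Q Unit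
  | 0, _ => failure
  | _ + 1, [] => tick
  | k + 1, (n, P) :: st => do
      tick
      let c ← readCell n
      match c with
      | .bottom i _ =>
          emit i j P
          enumRounds τ j k st
      | .output pos m _ => enumRounds τ j k ((m, pos :: P) :: st)
      | .union l r _ =>
          let mr ← readMax r
          if τ ≤ mr then enumRounds τ j k ((l, P) :: (r, P) :: st)
          else enumRounds τ j k ((l, P) :: st)

open Classical in
/-- The depth-first search of `Enumerate`, without a bound on the number of rounds: its result is
the one for any number of rounds within which it ends, and it fails if there is no such number. -/
noncomputable def enumLoop (τ j : ℕ) (stack : List (NodeId × List ℕ)) : RAM Q Unit := fun s =>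
  if h : ∃ k, ((enumRounds τ j k stack).run s).isSome then
    (enumRounds τ j (Nat.find h) stack).run s
  else none

/-- Enumerate the open complex events of the node `n`, closed at `j`, that start at or after
`j - ε` (truncated subtraction is harmless here, as positions are not negative). -/
noncomputable def enumerate (n : NodeId) (ε j : ℕ) : RAM Q Unit := do
  let m ← readMax n
  if j - ε ≤ m then enumLoop (j - ε) j [(n, [])] else enumLoop (j - ε) j []

noncomputable def outputKeys (A : CEA Tup Q) (ε j : ℕ) : Table Q → RAM Q Unit
  | [] => tick
  | (p, U) :: T => do
      tick
      if p ∈ A.F then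
        let n ← listMerge U
        enumerate n ε j
      outputKeys A ε j T

/-- The procedure `Output`. -/
noncomputable def output (A : CEA Tup Q) (ε j : ℕ) : RAM Q Unit := do
  let s ← get
  outputKeys A ε j s.T

/-- The state of the machine after `n` iterations of `Evaluation` (that is, after the iterations
with numbers `0, …, n - 1`), or after all iterations if the stream has fewer than `n` tuples;
`none` if the machine has failed. -/
noncomputable def evaluation (A : CEA Tup Q) (S : Stream'.Seq Tup) (ε : ℕ) :
    ℕ → Option (Machine Q)
  | 0 => some { ecs := #[], T := [], T' := [], clock := 0, log := [] }
  | n + 1 => do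
      let s ← evaluation A S ε n
      match S.get? n with
      | none => pure s
      | some t =>
          let (_, s₁) ← (update A t n).run s
          let (_, s₂) ← (output A ε n).run s₁
          pure s₂

end Programs

/-- `DelayBounded f d a L b`: in an enumeration that starts at time `a`, ends at time `b`, and
prints the events of `L` (each given with the time at which its printing was complete), every event
`C` is printed within `f C` steps of the previous one (of the start, if it is the first), and the
enumeration ends within `d` steps of the last one (of the start, if there is none). -/
def DelayBounded (f : ComplexEvent → ℕ) (d : ℕ) : ℕ → List (ComplexEvent × ℕ) → ℕ → Prop
  | a, [], b => b ≤ a + d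
  | a, (C, x) :: L, b => x ≤ a + f C ∧ DelayBounded f d x L b

end CER

/-!
The proof keeps three invariants, one for the memory, one for a hash table, one for the algorithm.

*Memory.* The tECS is append-only, and every pointer goes to an older cell. Hence the open complex
events, the maximum-start and the output-depth of a node never change once it exists
(`TECS.Valid.openEvents_ext`, `TECS.Valid.maxStart_ext`, `TECS.ODepth.ext`), and the properties
required of the data structure have to be checked for new nodes only (`TECS.Valid.push`). A union
node is good as soon as its children represent disjoint sets, its left child has at least the
maximum-start of the right one, and the left child has output-depth at most `2`. The methods `union`
(`wp_union`), `insert` (`wp_listInsert`) and `merge` (`wp_listMerge`) create only such nodes, and the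
nodes that they return or put into a list are safe. An output node carries a label
larger than all labels below it, so that adding the label is injective.

*Hash table.* Let `CEA.openRuns A S n q` be the set of pairs `(i, D)` of the runs that start at `i`,
have read the tuples before position `n`, and end in `q`. The table represents exactly these sets
(`Invariant`). By I/O-determinism the pair `(i, D)` determines the run, by induction on its length
(`CEA.activeRuns_unique`, `CEA.moves_unique`), so the sets of different states are disjoint, and so
are the contributions of different states to the new set of a state (`CEA.disjoint_moves`). This is
what makes all unions disjoint. As the keys are processed by non-increasing maximum-start, every
insertion is legal, and the new table is sorted again.

*Length of the union-lists.* The first node of a list keeps its maximum-start `h` as long as the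
list is handed on. The other maximum-starts in the list were inserted at iteration `h` or later, and
since no start smaller than `h` can become the maximum-start of a first node anew, they belong to the
set `K h` that consists of `h` and of the maximum-starts of the first nodes before iteration `h`.
This set has at most `|Q|` elements, as the initial state is no key (`GoodTable`, `wp_update`).

*Time.* The number of keys is at most `|Q|` and at most `|Δ|`, and inserting and extending happen
only if there is a transition, which gives the bound `O(|Q| * |Δ| + 1)` for the update. In the
depth-first search every visited node has an output below it, since the left child has the same
maximum-start as its parent and a right child is tested before it is visited. Because
output-depths are at most `3`, the search meets a non-union node after at most three union nodes,
so the delay is linear in the size of the next output (`enumRounds_node`). Between the searches for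
different keys only `merge` is called, which costs `O(|Q|)` steps for each of at most `|Q|` keys
(`wp_outputKeys`).
-/

namespace CER

/-! ### Timed enumerable compact sets -/

namespace TECS

/-- `Ext E E'`: the memory `E'` arises from `E` by appending cells. -/
def Ext (E E' : TECS) : Prop := E.size ≤ E'.size ∧ ∀ n, n < E.size → E'[n]? = E[n]?

theorem Ext.refl (E : TECS) : Ext E E := ⟨le_rfl, fun _ _ => rfl⟩

theorem Ext.trans {E₁ E₂ E₃ : TECS} (h : Ext E₁ E₂) (h' : Ext E₂ E₃) : Ext E₁ E₃ :=
  ⟨h.1.trans h'.1, fun n hn => (h'.2 n (hn.trans_le h.1)).trans (h.2 n hn)⟩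

theorem Ext.push (E : TECS) (c : Cell) : Ext E (E.push c) := by
  refine ⟨by simp, fun n hn => ?_⟩
  rw [Array.getElem?_push, if_neg hn.ne]

theorem lt_size_of_get {E : TECS} {n : ℕ} {c : Cell} (h : E[n]? = some c) : n < E.size := by
  by_contra hn
  rw [Array.getElem?_eq_none (not_lt.mp hn)] at h
  cases h

theorem get_push_size (E : TECS) (c : Cell) : (E.push c)[E.size]? = some c := by simp

theorem Ext.get {E E' : TECS} (h : Ext E E') {n : ℕ} {c : Cell} (hc : E[n]? = some c) :
    E'[n]? = some c := (h.2 n (lt_size_of_get hc)).trans hc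

theorem FullPath.lt_size {E : TECS} {n : ℕ} {p : List NodeId} {i : ℕ} {D : Finset ℕ}
    (h : FullPath E n p i D) : n < E.size := by
  cases h <;> exact lt_size_of_get ‹_›

theorem FullPath.ext {E E' : TECS} (h : Ext E E') {n : ℕ} {p : List NodeId} {i : ℕ} {D : Finset ℕ}
    (hp : FullPath E n p i D) : FullPath E' n p i D := by
  induction hp with
  | bottom h0 => exact .bottom (h.get h0)
  | output h0 _ ih => exact .output (h.get h0) ih
  | left h0 _ ih => exact .left (h.get h0) ih
  | right h0 _ ih => exact .right (h.get h0) ih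

theorem FullPath.of_ext {E E' : TECS} (h : Ext E E') (hE : ∀ n m, Child E n m → m < n)
    {n : ℕ} {p : List NodeId} {i : ℕ} {D : Finset ℕ} (hp : FullPath E' n p i D)
    (hn : n < E.size) : FullPath E n p i D := by
  induction hp with
  | bottom h0 => exact .bottom ((h.2 _ hn).symm.trans h0)
  | output h0 _ ih =>
    have h1 := (h.2 _ hn).symm.trans h0
    exact .output h1 (ih ((hE _ _ (.next h1)).trans hn))
  | left h0 _ ih =>
    have h1 := (h.2 _ hn).symm.trans h0
    exact .left h1 (ih ((hE _ _ (.left h1)).trans hn))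
  | right h0 _ ih =>
    have h1 := (h.2 _ hn).symm.trans h0
    exact .right h1 (ih ((hE _ _ (.right h1)).trans hn))

theorem openEvents_ext {E E' : TECS} (h : Ext E E') (hE : ∀ n m, Child E n m → m < n)
    {n : ℕ} (hn : n < E.size) : openEvents E' n = openEvents E n :=
  Set.ext fun _ => ⟨fun ⟨p, hp⟩ => ⟨p, hp.of_ext h hE hn⟩, fun ⟨p, hp⟩ => ⟨p, hp.ext h⟩⟩

theorem IsNonUnion.ext {E E' : TECS} (h : Ext E E') {n : ℕ} (hn : IsNonUnion E n) :
    IsNonUnion E' n :=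
  ⟨hn.1.trans_le h.1, fun ⟨l, r, x, hc⟩ => hn.2 ⟨l, r, x, (h.2 _ hn.1).symm.trans hc⟩⟩

theorem ODepth.ext {E E' : TECS} (h : Ext E E') {n d : ℕ} (hn : ODepth E n d) :
    ODepth E' n d := by
  induction hn with
  | zero h0 => exact .zero (h0.ext h)
  | succ h0 _ ih => exact .succ (h.get h0) ih

theorem Safe.ext {E E' : TECS} (h : Ext E E') {n : ℕ} (hn : Safe E n) : Safe E' n := by
  rcases hn with hn | ⟨l, r, x, hc, h1, d, hd, h2⟩
  · exact .inl (hn.ext h)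
  · exact .inr ⟨l, r, x, h.get hc, h1.ext h, d, hd, h2.ext h⟩

theorem Safe.lt_size {E : TECS} {n : ℕ} (hn : Safe E n) : n < E.size := by
  rcases hn with hn | ⟨l, r, x, hc, _⟩
  · exact hn.1
  · exact lt_size_of_get hc

theorem Safe.exists_oDepth_le_one {E : TECS} {n : ℕ} (hn : Safe E n) :
    ∃ d ≤ 1, ODepth E n d := by
  rcases hn with hn | ⟨l, r, x, _, h1, _⟩
  · exact ⟨0, by omega, .zero hn⟩
  · exact ⟨1, le_rfl, h1⟩

theorem ODepth.isNonUnion {E : TECS} {n : ℕ} (hn : ODepth E n 0) : IsNonUnion E n := by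
  cases hn with
  | zero h => exact h

theorem ODepth.of_succ {E : TECS} {n l r x d : ℕ} (hn : ODepth E n (d + 1))
    (hc : E[n]? = some (.union l r x)) : ODepth E l d := by
  cases hn with
  | succ h0 h1 =>
    rw [hc] at h0
    cases h0
    exact h1

/-- The invariant of the memory: pointers go to older cells, the graph has the properties required
of the data structure, and the label of an output node exceeds all labels of output nodes below
it. That the children of a union node represent disjoint sets is a separate condition: a union node
with two equal children does not violate `DuplicateFree`, since its full-paths, as lists of nodes,
do not show which child was taken. -/
structure Valid (E : TECS) : Prop where
  lt : ∀ n m, Child E n m → m < n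
  timeOrdered : TimeOrdered E
  kBounded : KBounded 3 E
  duplicateFree : DuplicateFree E
  labels : ∀ n k m x : ℕ, E[n]? = some (Cell.output k m x) →
    ∀ o ∈ openEvents E m, o.1 ≤ k ∧ ∀ d ∈ o.2, d < k
  disjoint : ∀ n l r x : ℕ, E[n]? = some (Cell.union l r x) →
    Disjoint (openEvents E l) (openEvents E r)

theorem Valid.isDAG {E : TECS} (hE : Valid E) : IsDAG E := by
  refine ⟨fun n m h => (hE.lt n m h).trans ?_, fun n h => ?_⟩
  · cases h <;> exact lt_size_of_get ‹_›
  · have key : ∀ a b, Relation.TransGen (Child E) a b → b < a := by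
      intro a b hab
      induction hab with
      | single h => exact hE.lt _ _ h
      | tail _ h ih => exact (hE.lt _ _ h).trans ih
    exact (key n n h).false

theorem Valid.maxStart_eq {E : TECS} (hE : Valid E) {n : ℕ} {c : Cell} (hc : E[n]? = some c) :
    maxStart E n = c.max := (hE.timeOrdered.1 n c hc).csSup_eq

theorem Valid.isGreatest {E : TECS} (hE : Valid E) {n : ℕ} (hn : n < E.size) :
    IsGreatest (starts E n) (maxStart E n) := by
  have hc : E[n]? = some E[n] := by simp
  rw [hE.maxStart_eq hc]
  exact hE.timeOrdered.1 n _ hc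

theorem Valid.le_maxStart {E : TECS} (hE : Valid E) {n : ℕ} {o : ℕ × Finset ℕ}
    (ho : o ∈ openEvents E n) : o.1 ≤ maxStart E n :=
  (hE.isGreatest (let ⟨_, hp⟩ := ho; hp.lt_size)).2 ⟨o.2, ho⟩

theorem Valid.exists_start {E : TECS} (hE : Valid E) {n : ℕ} (hn : n < E.size) :
    ∃ o ∈ openEvents E n, o.1 = maxStart E n := by
  obtain ⟨D, hD⟩ := (hE.isGreatest hn).1
  exact ⟨_, hD, rfl⟩

theorem Valid.openEvents_ext {E E' : TECS} (hE : Valid E) (h : Ext E E') {n : ℕ}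
    (hn : n < E.size) : openEvents E' n = openEvents E n := TECS.openEvents_ext h hE.lt hn

theorem Valid.maxStart_ext {E E' : TECS} (hE : Valid E) (h : Ext E E') {n : ℕ}
    (hn : n < E.size) : maxStart E' n = maxStart E n := by
  unfold maxStart starts
  rw [hE.openEvents_ext h hn]

theorem Valid.child_lt_size {E : TECS} (hE : Valid E) {n m : ℕ} (h : Child E n m) :
    m < E.size := hE.isDAG.1 n m h

/-- The maximum-start of a union node is the one of its left child. -/
theorem Valid.maxStart_left {E : TECS} (hE : Valid E) {n l r x : ℕ}
    (h : E[n]? = some (.union l r x)) : maxStart E n = maxStart E l := by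
  refine le_antisymm ?_ ?_
  · obtain ⟨⟨i, D⟩, ⟨p, hp⟩, h1⟩ := hE.exists_start (lt_size_of_get h)
    rw [← h1]
    cases hp with
    | left h0 h1 =>
      rw [h] at h0; cases h0
      exact hE.le_maxStart (o := (i, D)) ⟨_, h1⟩
    | right h0 h1 =>
      rw [h] at h0; cases h0
      exact (hE.le_maxStart (o := (i, D)) ⟨_, h1⟩).trans (hE.timeOrdered.2 _ _ _ _ h)
    | _ => simp_all
  · obtain ⟨⟨i, D⟩, ⟨p, hp⟩, h1⟩ := hE.exists_start (hE.child_lt_size (.left h))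
    exact h1 ▸ hE.le_maxStart (o := (i, D)) ⟨_, .left h hp⟩

theorem openEvents_of_bottom {E : TECS} {n i x : ℕ} (h : E[n]? = some (.bottom i x)) :
    openEvents E n = {(i, ∅)} := by
  ext ⟨i', D⟩
  constructor
  · rintro ⟨p, hp⟩
    cases hp <;> simp_all
  · rintro ⟨⟩
    exact ⟨_, .bottom h⟩

theorem openEvents_of_output {E : TECS} {n k m x : ℕ} (h : E[n]? = some (.output k m x)) :
    openEvents E n = (fun o => (o.1, insert k o.2)) '' openEvents E m := by
  ext ⟨i', D⟩
  constructor
  · rintro ⟨p, hp⟩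
    cases hp with
    | output h0 h1 =>
      rw [h] at h0; cases h0
      exact ⟨(_, _), ⟨_, h1⟩, rfl⟩
    | _ => simp_all
  · rintro ⟨⟨i, D'⟩, ⟨p, hp⟩, ⟨⟩⟩
    exact ⟨_, .output h hp⟩

theorem openEvents_of_union {E : TECS} {n l r x : ℕ} (h : E[n]? = some (.union l r x)) :
    openEvents E n = openEvents E l ∪ openEvents E r := by
  ext ⟨i', D⟩
  constructor
  · rintro ⟨p, hp⟩
    cases hp with
    | left h0 h1 =>
      rw [h] at h0; cases h0
      exact .inl ⟨_, h1⟩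
    | right h0 h1 =>
      rw [h] at h0; cases h0
      exact .inr ⟨_, h1⟩
    | _ => simp_all
  · rintro (⟨p, hp⟩ | ⟨p, hp⟩)
    · exact ⟨_, .left h hp⟩
    · exact ⟨_, .right h hp⟩

/-- Appending a cell preserves the invariant if the new node satisfies it. -/
theorem Valid.push {E : TECS} (hE : Valid E) (c : Cell)
    (hlt : ∀ m, Child (E.push c) E.size m → m < E.size)
    (hmax : IsGreatest (starts (E.push c) E.size) c.max)
    (hord : ∀ l r x, c = .union l r x → maxStart E r ≤ maxStart E l)
    (hdepth : ∃ d ≤ 3, ODepth (E.push c) E.size d)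
    (hdup : ∀ p p' i D, FullPath (E.push c) E.size p i D →
      FullPath (E.push c) E.size p' i D → p = p')
    (hlab : ∀ k m x, c = .output k m x → ∀ o ∈ openEvents E m, o.1 ≤ k ∧ ∀ d ∈ o.2, d < k)
    (hdisj : ∀ l r x, c = .union l r x → Disjoint (openEvents E l) (openEvents E r)) :
    Valid (E.push c) := by
  have hext := Ext.push E c
  have hold : ∀ {n c'}, (E.push c)[n]? = some c' →
      (n < E.size ∧ E[n]? = some c') ∨ (n = E.size ∧ c = c') := by
    intro n c' h
    rw [Array.getElem?_push] at h
    split_ifs at h with hn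
    · exact .inr ⟨hn, Option.some.inj h⟩
    · exact .inl ⟨lt_size_of_get h, h⟩
  have hchild : ∀ n m, Child (E.push c) n m → m < n := by
    intro n m h
    by_cases hn : n = E.size
    · subst hn; exact hlt m h
    · apply hE.lt
      cases h with
      | next h => exact .next ((hold h).resolve_right fun h => hn h.1).2
      | left h => exact .left ((hold h).resolve_right fun h => hn h.1).2
      | right h => exact .right ((hold h).resolve_right fun h => hn h.1).2
  refine ⟨hchild, ⟨?_, ?_⟩, ?_, ?_, ?_, ?_⟩
  · intro n c' h
    rcases hold h with ⟨hn, h'⟩ | ⟨rfl, rfl⟩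
    · have := hE.timeOrdered.1 n c' h'
      unfold starts at this ⊢
      rwa [hE.openEvents_ext hext hn]
    · exact hmax
  · intro u l r x h
    rcases hold h with ⟨hn, h'⟩ | ⟨rfl, rfl⟩
    · rw [hE.maxStart_ext hext (hE.child_lt_size (.left h')),
        hE.maxStart_ext hext (hE.child_lt_size (.right h'))]
      exact hE.timeOrdered.2 u l r x h'
    · rw [hE.maxStart_ext hext (hlt _ (.left h)), hE.maxStart_ext hext (hlt _ (.right h))]
      exact hord _ _ _ rfl
  · intro n hn
    by_cases hn' : n = E.size
    · subst hn'; exact hdepth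
    · rw [Array.size_push] at hn
      obtain ⟨d, hd, h⟩ := hE.kBounded n ((Nat.lt_succ_iff.mp hn).lt_of_ne hn')
      exact ⟨d, hd, h.ext hext⟩
  · intro n p p' i i' D D' hp hp' hne heq
    cases heq
    by_cases hn' : n = E.size
    · subst hn'; exact hne (hdup _ _ _ _ hp hp')
    · have hn := hp.lt_size
      rw [Array.size_push] at hn
      have hn : n < E.size := (Nat.lt_succ_iff.mp hn).lt_of_ne hn'
      exact hE.duplicateFree n p p' i i D D (hp.of_ext hext hE.lt hn) (hp'.of_ext hext hE.lt hn)
        hne rfl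
  · intro n k m x h
    rcases hold h with ⟨hn, h'⟩ | ⟨rfl, rfl⟩
    · rw [hE.openEvents_ext hext (hE.child_lt_size (.next h'))]
      exact hE.labels n k m x h'
    · rw [hE.openEvents_ext hext (hlt _ (.next h))]
      exact hlab k m x rfl
  · intro n l r x h
    rcases hold h with ⟨hn, h'⟩ | ⟨rfl, rfl⟩
    · rw [hE.openEvents_ext hext (hE.child_lt_size (.left h')),
        hE.openEvents_ext hext (hE.child_lt_size (.right h'))]
      exact hE.disjoint n l r x h'
    · rw [hE.openEvents_ext hext (hlt _ (.left h)), hE.openEvents_ext hext (hlt _ (.right h))]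
      exact hdisj l r x rfl

theorem isNonUnion_of_get {E : TECS} {n : ℕ} {c : Cell} (h : E[n]? = some c)
    (hc : ∀ l r x, c ≠ .union l r x) : IsNonUnion E n :=
  ⟨lt_size_of_get h, fun ⟨l, r, x, h'⟩ => hc l r x (Option.some.inj (h.symm.trans h'))⟩

theorem FullPath.eq_of_valid {E : TECS} (hE : Valid E) {n : ℕ} {p p' : List NodeId} {i : ℕ}
    {D : Finset ℕ} (h : FullPath E n p i D) (h' : FullPath E n p' i D) : p = p' := by
  by_contra hne
  exact hE.duplicateFree n p p' i i D D h h' hne rfl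

theorem Valid.push_bottom {E : TECS} (hE : Valid E) (i : ℕ) : Valid (E.push (.bottom i i)) := by
  have hg := get_push_size E (.bottom i i)
  refine hE.push _ ?_ ?_ (by simp) ?_ ?_ (by simp) (by simp)
  · intro m h
    cases h <;> simp_all
  · unfold starts
    rw [openEvents_of_bottom hg]
    constructor
    · exact ⟨∅, rfl⟩
    · rintro k ⟨D, h⟩
      cases h
      exact le_rfl
  · exact ⟨0, by omega, .zero (isNonUnion_of_get hg (by simp))⟩
  · intro p p' i D h h'
    generalize hD' : D = D' at h'
    cases h <;> cases h' <;> simp_all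

theorem Valid.push_output {E : TECS} (hE : Valid E) {k m x : ℕ} (hm : m < E.size)
    (hx : x = maxStart E m) (hlab : ∀ o ∈ openEvents E m, o.1 ≤ k ∧ ∀ d ∈ o.2, d < k) :
    Valid (E.push (.output k m x)) := by
  have hext := Ext.push E (.output k m x)
  have hg := get_push_size E (.output k m x)
  refine hE.push _ ?_ ?_ (by simp) ?_ ?_ ?_ (by simp)
  · intro m' h
    cases h <;> simp_all
  · unfold starts
    rw [openEvents_of_output hg, hE.openEvents_ext hext hm]
    change IsGreatest _ x
    rw [hx]
    obtain ⟨⟨i, D⟩, ho, h1⟩ := hE.exists_start hm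
    constructor
    · exact ⟨_, _, ho, by simp [← h1]; rfl⟩
    · rintro i' ⟨D', o', ho', h'⟩
      cases h'
      exact hE.le_maxStart ho'
  · exact ⟨0, by omega, .zero (isNonUnion_of_get hg (by simp))⟩
  · intro p p' i D h h'
    cases h with
    | @output _ _ _ _ _ _ D₁ h0 h1 =>
      rw [hg] at h0; cases h0
      generalize hD' : insert k D₁ = D' at h'
      cases h' with
      | output h0' h1' =>
        rw [hg] at h0'; cases h0'
        have h1 := h1.of_ext hext hE.lt hm
        have h1' := h1'.of_ext hext hE.lt hm
        -- The label `k` is new below, so it can be removed again from both sides.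
        have e := congrArg (fun s => Finset.erase s k) hD'
        rw [Finset.erase_insert, Finset.erase_insert] at e
        · subst e
          rw [h1.eq_of_valid hE h1']
        · exact fun hk => ((hlab (_, _) ⟨_, h1'⟩).2 k hk).false
        · exact fun hk => ((hlab (_, _) ⟨_, h1⟩).2 k hk).false
      | _ => simp_all
    | _ => simp_all
  · intro k' m' x' h
    cases h
    exact hlab

theorem Valid.push_union {E : TECS} (hE : Valid E) {l r x d : ℕ} (hl : l < E.size)
    (hr : r < E.size) (hx : x = maxStart E l) (hord : maxStart E r ≤ maxStart E l)
    (hd : d ≤ 2) (hdepth : ODepth E l d) (hdisj : Disjoint (openEvents E l) (openEvents E r)) :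
    Valid (E.push (.union l r x)) := by
  have hext := Ext.push E (.union l r x)
  have hg := get_push_size E (.union l r x)
  refine hE.push _ ?_ ?_ ?_ ?_ ?_ (by simp) ?_
  · intro m' h
    cases h <;> simp_all
  · unfold starts
    rw [openEvents_of_union hg, hE.openEvents_ext hext hl, hE.openEvents_ext hext hr]
    change IsGreatest _ x
    rw [hx]
    obtain ⟨⟨i, D⟩, ho, h1⟩ := hE.exists_start hl
    constructor
    · exact ⟨D, .inl (h1 ▸ ho)⟩
    · rintro i' ⟨D', ho' | ho'⟩
      · exact hE.le_maxStart ho'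
      · exact (hE.le_maxStart ho').trans hord
  · intro l' r' x' h
    cases h
    exact hord
  · exact ⟨d + 1, by omega, .succ hg (hdepth.ext hext)⟩
  · intro p p' i D h h'
    cases h with
    | left h0 h1 =>
      rw [hg] at h0; cases h0
      have h1 := h1.of_ext hext hE.lt hl
      cases h' with
      | left h0' h1' =>
        rw [hg] at h0'; cases h0'
        rw [h1.eq_of_valid hE (h1'.of_ext hext hE.lt hl)]
      | right h0' h1' =>
        rw [hg] at h0'; cases h0'
        exact (Set.disjoint_left.mp hdisj (show (i, D) ∈ _ from ⟨_, h1⟩)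
          ⟨_, h1'.of_ext hext hE.lt hr⟩).elim
      | _ => simp_all
    | right h0 h1 =>
      rw [hg] at h0; cases h0
      have h1 := h1.of_ext hext hE.lt hr
      cases h' with
      | left h0' h1' =>
        rw [hg] at h0'; cases h0'
        exact (Set.disjoint_left.mp hdisj (show (i, D) ∈ _ from
          ⟨_, h1'.of_ext hext hE.lt hl⟩) ⟨_, h1⟩).elim
      | right h0' h1' =>
        rw [hg] at h0'; cases h0'
        rw [h1.eq_of_valid hE (h1'.of_ext hext hE.lt hr)]
      | _ => simp_all
    | _ => simp_all
  · intro l' r' x' h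
    cases h
    exact hdisj

theorem valid_empty : Valid #[] := by
  have h0 : ∀ n : ℕ, (#[] : TECS)[n]? = none := fun n => by simp
  refine ⟨fun n m h => ?_, ⟨fun n c h => ?_, fun n l r x h => ?_⟩, fun n h => ?_, ?_, ?_, ?_⟩
  · cases h <;> simp_all
  · simp at h
  · simp at h
  · simp at h
  · intro n p p' i i' D D' h
    have := h.lt_size
    simp at this
  · intro n k m x h
    simp at h
  · intro n l r x h
    simp at h

end TECS

/-! ### Total correctness of programs -/

section Wp

variable {Q : Type} {α β : Type}

/-- Total correctness: started in the state `s`, the program `m` does not fail, and its result and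
its final state satisfy `post`. In the proofs below, states that differ in the clock only have
definitionally equal memories; there `by exact h` delays the elaboration of a fact `h` about the
memory until the state is known. -/
def Wp (m : RAM Q α) (s : Machine Q) (post : α → Machine Q → Prop) : Prop :=
  ∃ a s', m.run s = some (a, s') ∧ post a s'

theorem Wp.mono {m : RAM Q α} {s : Machine Q} {post post' : α → Machine Q → Prop}
    (h : Wp m s post) (hp : ∀ a s', post a s' → post' a s') : Wp m s post' := by
  obtain ⟨a, s', h1, h2⟩ := h
  exact ⟨a, s', h1, hp _ _ h2⟩

theorem Wp.bind {m : RAM Q α} {f : α → RAM Q β} {s : Machine Q}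
    {post : β → Machine Q → Prop} (h : Wp m s fun a s' => Wp (f a) s' post) :
    Wp (m >>= f) s post := by
  obtain ⟨a, s', h1, b, s'', h2, h3⟩ := h
  exact ⟨b, s'', by simp [h1, h2], h3⟩

theorem wp_pure {a : α} {s : Machine Q} {post : α → Machine Q → Prop} (h : post a s) :
    Wp (pure a) s post := ⟨a, s, rfl, h⟩

theorem wp_modify {f : Machine Q → Machine Q} {s : Machine Q} {post : Unit → Machine Q → Prop}
    (h : post () (f s)) : Wp (modify f) s post := ⟨(), f s, rfl, h⟩

theorem wp_tick {k : ℕ} {s : Machine Q} {post : Unit → Machine Q → Prop}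
    (h : post () { s with clock := s.clock + k }) : Wp (tick k) s post := wp_modify h

theorem wp_get {s : Machine Q} {post : Machine Q → Machine Q → Prop} (h : post s s) :
    Wp get s post := ⟨s, s, rfl, h⟩

theorem wp_readCell {n : NodeId} {c : Cell} {s : Machine Q} (hc : s.ecs[n]? = some c)
    {post : Cell → Machine Q → Prop} (h : post c { s with clock := s.clock + 1 }) :
    Wp (readCell n) s post := by
  refine Wp.bind (wp_tick (Wp.bind (wp_get ?_)))
  simp only [hc]
  exact wp_pure h

theorem wp_readMax {n : NodeId} {s : Machine Q} (hE : s.ecs.Valid) (hn : n < s.ecs.size)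
    {post : ℕ → Machine Q → Prop}
    (h : post (s.ecs.maxStart n) { s with clock := s.clock + 1 }) :
    Wp (readMax n) s post := by
  have hc : s.ecs[n]? = some s.ecs[n] := by simp
  rw [hE.maxStart_eq hc] at h
  exact Wp.bind (wp_readCell hc (wp_pure h))

theorem wp_alloc {c : Cell} {s : Machine Q} {post : NodeId → Machine Q → Prop}
    (h : post s.ecs.size { s with ecs := s.ecs.push c, clock := s.clock + 1 }) :
    Wp (alloc c) s post := ⟨_, _, rfl, h⟩

end Wp

open TECS

/-- `Step k s s'`: the machine has appended cells to a valid memory and has made at most `k` steps;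
nothing else has changed. -/
structure Step {Q : Type} (k : ℕ) (s s' : Machine Q) : Prop where
  valid : s'.ecs.Valid
  ext : Ext s.ecs s'.ecs
  T : s'.T = s.T
  T' : s'.T' = s.T'
  log : s'.log = s.log
  clock : s'.clock ≤ s.clock + k

section Methods

variable {Q : Type}

theorem Step.tick {s : Machine Q} (hE : s.ecs.Valid) (k : ℕ) :
    Step k s { s with clock := s.clock + k } := ⟨hE, .refl _, rfl, rfl, rfl, le_rfl⟩

theorem Step.mono {s s' : Machine Q} {k k' : ℕ} (h : Step k s s') (hk : k ≤ k') :
    Step k' s s' :=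
  ⟨h.valid, h.ext, h.T, h.T', h.log, h.clock.trans (Nat.add_le_add_left hk _)⟩

theorem Step.trans {s₁ s₂ s₃ : Machine Q} {k k' k'' : ℕ} (h : Step k s₁ s₂) (h' : Step k' s₂ s₃)
    (hk : k + k' ≤ k'') : Step k'' s₁ s₃ :=
  ⟨h'.valid, h.ext.trans h'.ext, h'.T.trans h.T, h'.T'.trans h.T', h'.log.trans h.log, by
    have := h.clock; have := h'.clock; omega⟩

/-! ### Methods of the data structure -/

theorem wp_newBottom {s : Machine Q} (hE : s.ecs.Valid) (i : ℕ) :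
    Wp (newBottom i) s fun n s' => Step 1 s s' ∧ IsNonUnion s'.ecs n ∧
      openEvents s'.ecs n = {(i, ∅)} ∧ maxStart s'.ecs n = i := by
  have hE' := hE.push_bottom i
  have hg := get_push_size s.ecs (.bottom i i)
  exact wp_alloc ⟨⟨hE', .push _ _, rfl, rfl, rfl, le_rfl⟩, isNonUnion_of_get hg (by simp),
    openEvents_of_bottom hg, hE'.maxStart_eq hg⟩

theorem wp_extend {s : Machine Q} (hE : s.ecs.Valid) {n : NodeId} (hn : n < s.ecs.size) {j : ℕ}
    (hlab : ∀ o ∈ openEvents s.ecs n, o.1 ≤ j ∧ ∀ d ∈ o.2, d < j) :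
    Wp (extend n j) s fun n' s' => Step 2 s s' ∧ IsNonUnion s'.ecs n' ∧
      openEvents s'.ecs n' = (fun o => (o.1, insert j o.2)) '' openEvents s.ecs n ∧
      maxStart s'.ecs n' = maxStart s.ecs n := by
  refine Wp.bind (wp_readMax hE hn ?_)
  have hE' := hE.push_output hn rfl hlab
  have hg := get_push_size s.ecs (.output j n (maxStart s.ecs n))
  refine wp_alloc ⟨⟨hE', .push _ _, rfl, rfl, rfl, ?_⟩, isNonUnion_of_get hg (by simp), ?_,
    hE'.maxStart_eq hg⟩
  · simp only; omega
  · rw [← hE.openEvents_ext (.push _ _) hn]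
    exact openEvents_of_output hg

theorem wp_newUnion {s : Machine Q} (hE : s.ecs.Valid) {l r d : ℕ} (hl : l < s.ecs.size)
    (hr : r < s.ecs.size) (hord : maxStart s.ecs r ≤ maxStart s.ecs l) (hd : d ≤ 2)
    (hdepth : ODepth s.ecs l d)
    (hdisj : Disjoint (openEvents s.ecs l) (openEvents s.ecs r)) :
    Wp (newUnion l r) s fun n s' => Step 3 s s' ∧
      (∃ x, s'.ecs[n]? = some (.union l r x)) ∧
      openEvents s'.ecs n = openEvents s.ecs l ∪ openEvents s.ecs r ∧
      maxStart s'.ecs n = maxStart s.ecs l ∧ ODepth s'.ecs n (d + 1) := by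
  refine Wp.bind (wp_readMax hE (by exact hl) (Wp.bind (wp_readMax (by exact hE) (by exact hr) ?_)))
  rw [max_eq_left hord]
  have hE' := hE.push_union hl hr rfl hord hd hdepth hdisj
  have hg := get_push_size s.ecs (.union l r (maxStart s.ecs l))
  have hx := Ext.push s.ecs (.union l r (maxStart s.ecs l))
  refine wp_alloc ⟨⟨hE', hx, rfl, rfl, rfl, ?_⟩, ⟨_, hg⟩, ?_, hE'.maxStart_eq hg,
    .succ hg (hdepth.ext hx)⟩
  · simp only; omega
  · rw [← hE.openEvents_ext hx hl, ← hE.openEvents_ext hx hr]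
    exact openEvents_of_union hg

/-- A safe union node, its left child being a non-union node. -/
theorem safe_of_union {E : TECS} {n l r x d : ℕ} (h : E[n]? = some (.union l r x))
    (h0 : IsNonUnion E l) (hd : d ≤ 2) (h1 : ODepth E r d) : Safe E n :=
  .inr ⟨l, r, x, h, .succ h (.zero h0), d, hd, h1⟩

/-- The method `union` on safe nodes with equal maximum-starts and disjoint sets of open complex
events. If both are union nodes, the left children are non-union nodes that attain the common
maximum-start, so that they may be placed above the union of the right children. -/
theorem wp_union {s : Machine Q} (hE : s.ecs.Valid) {n₁ n₂ : ℕ} (h₁ : Safe s.ecs n₁)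
    (h₂ : Safe s.ecs n₂) (hmax : maxStart s.ecs n₁ = maxStart s.ecs n₂)
    (hdisj : Disjoint (openEvents s.ecs n₁) (openEvents s.ecs n₂)) :
    Wp (union n₁ n₂) s fun n s' => Step 13 s s' ∧ Safe s'.ecs n ∧
      openEvents s'.ecs n = openEvents s.ecs n₁ ∪ openEvents s.ecs n₂ ∧
      maxStart s'.ecs n = maxStart s.ecs n₁ := by
  obtain ⟨c₁, hc₁⟩ : ∃ c, s.ecs[n₁]? = some c := ⟨s.ecs[n₁]'h₁.lt_size, by simp⟩
  obtain ⟨c₂, hc₂⟩ : ∃ c, s.ecs[n₂]? = some c := ⟨s.ecs[n₂]'h₂.lt_size, by simp⟩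
  have hs : Step 2 s { s with clock := s.clock + 1 + 1 } := Step.tick hE 2
  refine Wp.bind (wp_readCell hc₁ (Wp.bind (wp_readCell (by exact hc₂) ?_)))
  -- The two cases in which one of the nodes is a non-union node.
  have hleft : IsNonUnion s.ecs n₁ → Wp (newUnion n₁ n₂)
      { s with clock := s.clock + 1 + 1 } fun n s' => Step 13 s s' ∧ Safe s'.ecs n ∧
      openEvents s'.ecs n = openEvents s.ecs n₁ ∪ openEvents s.ecs n₂ ∧
      maxStart s'.ecs n = maxStart s.ecs n₁ := by
    intro h0
    obtain ⟨d, hd, hd'⟩ := h₂.exists_oDepth_le_one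
    refine (wp_newUnion (d := 0) (by exact hE) (by exact h₁.lt_size) (by exact h₂.lt_size)
      (by exact hmax.ge) (by omega) (.zero (by exact h0))
      (by exact hdisj)).mono ?_
    rintro n s' ⟨h1, ⟨x, h2⟩, h3, h4, -⟩
    exact ⟨hs.trans h1 (by omega), safe_of_union h2 (h0.ext h1.ext) (by omega) (hd'.ext h1.ext),
      h3, h4⟩
  have hright : IsNonUnion s.ecs n₂ → Wp (newUnion n₂ n₁)
      { s with clock := s.clock + 1 + 1 } fun n s' => Step 13 s s' ∧ Safe s'.ecs n ∧
      openEvents s'.ecs n = openEvents s.ecs n₁ ∪ openEvents s.ecs n₂ ∧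
      maxStart s'.ecs n = maxStart s.ecs n₁ := by
    intro h0
    obtain ⟨d, hd, hd'⟩ := h₁.exists_oDepth_le_one
    refine (wp_newUnion (d := 0) (by exact hE) (by exact h₂.lt_size) (by exact h₁.lt_size)
      (by exact hmax.le) (by omega) (.zero (by exact h0))
      (by exact hdisj.symm)).mono ?_
    rintro n s' ⟨h1, ⟨x, h2⟩, h3, h4, -⟩
    exact ⟨hs.trans h1 (by omega), safe_of_union h2 (h0.ext h1.ext) (by omega) (hd'.ext h1.ext),
      h3.trans (Set.union_comm _ _), h4.trans hmax.symm⟩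
  rcases h₁ with h₁ | ⟨l₁, r₁, x₁, hu₁, ho₁, d₁, hd₁, hr₁⟩
  · cases c₁ with
    | union l r x => exact (h₁.2 ⟨_, _, _, hc₁⟩).elim
    | bottom => exact hleft h₁
    | output => exact hleft h₁
  rw [hc₁] at hu₁
  cases hu₁
  rcases h₂ with h₂ | ⟨l₂, r₂, x₂, hu₂, ho₂, d₂, hd₂, hr₂⟩
  · cases c₂ with
    | union l r x => exact (h₂.2 ⟨_, _, _, hc₂⟩).elim
    | bottom => exact hright h₂
    | output => exact hright h₂
  rw [hc₂] at hu₂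
  cases hu₂
  have hl₁ := (ho₁.of_succ hc₁).isNonUnion
  have hl₂ := (ho₂.of_succ hc₂).isNonUnion
  have hrs₁ := hE.child_lt_size (.right hc₁)
  have hrs₂ := hE.child_lt_size (.right hc₂)
  have he₁ := openEvents_of_union hc₁
  have he₂ := openEvents_of_union hc₂
  have hm₁ := hE.maxStart_left hc₁
  have hm₂ := hE.maxStart_left hc₂
  have ht₁ := hE.timeOrdered.2 _ _ _ _ hc₁
  have ht₂ := hE.timeOrdered.2 _ _ _ _ hc₂
  have hb₁ := hE.disjoint _ _ _ _ hc₁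
  have hb₂ := hE.disjoint _ _ _ _ hc₂
  rw [he₁, he₂, Set.disjoint_union_left, Set.disjoint_union_right, Set.disjoint_union_right]
    at hdisj
  obtain ⟨⟨hll, hlr⟩, hrl, hrr⟩ := hdisj
  refine Wp.bind (wp_readMax (by exact hE) (by exact hrs₁)
    (Wp.bind (wp_readMax (by exact hE) (by exact hrs₂) ?_)))
  have hs : Step 4 s { s with clock := s.clock + 1 + 1 + 1 + 1 } := Step.tick hE 4
  -- `u₂` is the union of the right children, in either order.
  suffices hcont : ∀ u₂ s₁, Step 7 s s₁ →
      openEvents s₁.ecs u₂ = openEvents s.ecs r₁ ∪ openEvents s.ecs r₂ →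
      maxStart s₁.ecs u₂ ≤ maxStart s.ecs n₁ → u₂ < s₁.ecs.size →
      Wp (newUnion l₂ u₂ >>= fun u₁ => newUnion l₁ u₁) s₁ fun n s' => Step 13 s s' ∧
        Safe s'.ecs n ∧
        openEvents s'.ecs n = openEvents s.ecs n₁ ∪ openEvents s.ecs n₂ ∧
        maxStart s'.ecs n = maxStart s.ecs n₁ by
    dsimp only
    split_ifs with hle
    · refine Wp.bind ((wp_newUnion (by exact hE) (by exact hrs₁) (by exact hrs₂) (by exact hle)
        hd₁ (by exact hr₁) (by exact hrr)).mono ?_)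
      rintro n s' ⟨h1, ⟨x, h2⟩, h3, h4, -⟩
      exact hcont n s' (hs.trans h1 (by omega)) h3 (by simp only at h4; omega) (lt_size_of_get h2)
    · refine Wp.bind ((wp_newUnion (by exact hE) (by exact hrs₂) (by exact hrs₁) 
        (by exact (not_le.mp hle).le) hd₂ (by exact hr₂) (by exact hrr.symm)).mono ?_)
      rintro n s' ⟨h1, ⟨x, h2⟩, h3, h4, -⟩
      exact hcont n s' (hs.trans h1 (by omega)) (h3.trans (Set.union_comm _ _))
        (by simp only at h4; omega) (lt_size_of_get h2)
  intro u₂ s₁ hs₁ he hmu hlt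
  have hll₁ := hE.child_lt_size (.left hc₁)
  have hll₂ := hE.child_lt_size (.left hc₂)
  have hev {n} (hn : n < s.ecs.size) := hE.openEvents_ext hs₁.ext hn
  have hmx {n} (hn : n < s.ecs.size) := hE.maxStart_ext hs₁.ext hn
  refine Wp.bind ((wp_newUnion (d := 0) hs₁.valid (hl₂.ext hs₁.ext).1 hlt ?_ (by omega)
    (.zero (hl₂.ext hs₁.ext)) ?_).mono ?_)
  · rw [hmx hll₂]; omega
  · rw [hev hll₂, he, Set.disjoint_union_right]
    exact ⟨hrl.symm, hb₂⟩
  rintro u₁ s₂ ⟨hs₂, ⟨x, hx⟩, he', hmu', ho⟩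
  have hs₁₂ := hs₁.trans hs₂ le_rfl
  refine (wp_newUnion (d := 0) hs₂.valid (hl₁.ext hs₁₂.ext).1 (lt_size_of_get hx) ?_ (by omega)
    (.zero (hl₁.ext hs₁₂.ext)) ?_).mono ?_
  · rw [hmu', hmx hll₂, hE.maxStart_ext hs₁₂.ext hll₁]; omega
  · rw [hE.openEvents_ext hs₁₂.ext hll₁, he', hev hll₂, he, Set.disjoint_union_right,
      Set.disjoint_union_right]
    exact ⟨hll, hb₁, hlr⟩
  rintro n s₃ ⟨hs₃, ⟨y, hy⟩, he'', hmu'', -⟩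
  refine ⟨hs₁₂.trans hs₃ (by omega), safe_of_union hy (hl₁.ext (hs₁₂.ext.trans hs₃.ext))
    (by omega) (ho.ext hs₃.ext), ?_, ?_⟩
  · rw [he'', hE.openEvents_ext hs₁₂.ext hll₁, he', hev hll₂, he, he₁, he₂]
    ac_rfl
  · rw [hmu'', hE.maxStart_ext hs₁₂.ext hll₁, hm₁]

end Methods

/-! ### Union-lists -/

namespace TECS

/-- The open complex events that are represented by the nodes of a list. -/
def listEvents (E : TECS) (U : List NodeId) : Set (ℕ × Finset ℕ) :=
  {o | ∃ n ∈ U, o ∈ openEvents E n}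

theorem listEvents_cons (E : TECS) (n : NodeId) (U : List NodeId) :
    listEvents E (n :: U) = openEvents E n ∪ listEvents E U := by
  ext o
  simp [listEvents]

theorem listEvents_nil (E : TECS) : listEvents E [] = ∅ := by
  ext o
  simp [listEvents]

theorem openEvents_subset_listEvents {E : TECS} {n : NodeId} {U : List NodeId} (h : n ∈ U) :
    openEvents E n ⊆ listEvents E U := fun _ ho => ⟨n, h, ho⟩

theorem disjoint_listEvents {E : TECS} {X : Set (ℕ × Finset ℕ)} {U : List NodeId} :
    Disjoint X (listEvents E U) ↔ ∀ n ∈ U, Disjoint X (openEvents E n) := by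
  constructor
  · exact fun h n hn => h.mono_right (openEvents_subset_listEvents hn)
  · intro h
    rw [Set.disjoint_left]
    rintro o ho ⟨n, hn, ho'⟩
    exact Set.disjoint_left.mp (h n hn) ho ho'

/-- The conditions on the part `n₁, …, n_k` of a union-list, together with disjointness of the
represented sets. -/
structure GoodTail (E : TECS) (ns : List NodeId) : Prop where
  safe : ∀ n ∈ ns, Safe E n
  sorted : ns.Pairwise fun a b => maxStart E b < maxStart E a
  disjoint : ns.Pairwise fun a b => Disjoint (openEvents E a) (openEvents E b)

/-- A union-list whose nodes represent pairwise disjoint sets. -/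
structure GoodList (E : TECS) (U : List NodeId) : Prop where
  isUnionList : IsUnionList E U
  disjoint : U.Pairwise fun a b => Disjoint (openEvents E a) (openEvents E b)

theorem GoodList.exists_eq_cons {E : TECS} {U : List NodeId} (h : GoodList E U) :
    ∃ n ns, U = n :: ns := by
  cases U with
  | nil => exact h.isUnionList.elim
  | cons n ns => exact ⟨n, ns, rfl⟩

theorem goodList_cons {E : TECS} {n₀ : NodeId} {ns : List NodeId} :
    GoodList E (n₀ :: ns) ↔ GoodTail E ns ∧ IsNonUnion E n₀ ∧
      (∀ n ∈ ns, maxStart E n ≤ maxStart E n₀) ∧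
      Disjoint (openEvents E n₀) (listEvents E ns) := by
  rw [disjoint_listEvents]
  constructor
  · rintro ⟨⟨h1, h2, h3, h4⟩, h5⟩
    rw [List.pairwise_cons] at h5
    exact ⟨⟨fun n hn => h1 n (by simp [hn]), h4, h5.2⟩, h2, h3, h5.1⟩
  · rintro ⟨⟨h1, h2, h3⟩, h4, h5, h6⟩
    refine ⟨⟨?_, h4, h5, h2⟩, List.pairwise_cons.mpr ⟨h6, h3⟩⟩
    intro n hn
    rcases List.mem_cons.mp hn with rfl | hn
    · exact .inl h4
    · exact h1 n hn

theorem goodList_singleton {E : TECS} {n : NodeId} (h : IsNonUnion E n) : GoodList E [n] :=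
  goodList_cons.mpr ⟨⟨by simp, .nil, .nil⟩, h, by simp, by simp [listEvents_nil]⟩

theorem GoodList.lt_size {E : TECS} {U : List NodeId} (h : GoodList E U) {n : NodeId}
    (hn : n ∈ U) : n < E.size := by
  obtain ⟨n₀, ns, rfl⟩ := h.exists_eq_cons
  exact (h.isUnionList.1 n hn).lt_size

theorem Valid.listEvents_ext {E E' : TECS} (hE : Valid E) (h : Ext E E') {U : List NodeId}
    (hU : ∀ n ∈ U, n < E.size) : listEvents E' U = listEvents E U := by
  ext o
  constructor <;> rintro ⟨n, hn, ho⟩ <;> refine ⟨n, hn, ?_⟩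
  · rwa [hE.openEvents_ext h (hU n hn)] at ho
  · rwa [hE.openEvents_ext h (hU n hn)]

theorem GoodTail.ext {E E' : TECS} (hE : Valid E) (h : Ext E E') {ns : List NodeId}
    (hns : GoodTail E ns) : GoodTail E' ns := by
  refine ⟨fun n hn => (hns.safe n hn).ext h, ?_, ?_⟩
  · refine hns.sorted.imp_of_mem fun {a b} ha hb hab => ?_
    rwa [hE.maxStart_ext h (hns.safe a ha).lt_size, hE.maxStart_ext h (hns.safe b hb).lt_size]
  · refine hns.disjoint.imp_of_mem fun {a b} ha hb hab => ?_
    rwa [hE.openEvents_ext h (hns.safe a ha).lt_size, hE.openEvents_ext h (hns.safe b hb).lt_size]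

theorem GoodList.ext {E E' : TECS} (hE : Valid E) (h : Ext E E') {U : List NodeId}
    (hU : GoodList E U) : GoodList E' U := by
  have hlt := fun n hn => hU.lt_size (n := n) hn
  obtain ⟨n₀, ns, rfl⟩ := hU.exists_eq_cons
  rw [goodList_cons] at hU ⊢
  obtain ⟨h1, h2, h3, h4⟩ := hU
  have hlt' := fun n hn => (h1.safe n hn).lt_size
  refine ⟨h1.ext hE h, h2.ext h, fun n hn => ?_, ?_⟩
  · rw [hE.maxStart_ext h (hlt' n hn), hE.maxStart_ext h h2.1]
    exact h3 n hn
  · rwa [hE.openEvents_ext h h2.1, hE.listEvents_ext h hlt']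

theorem listMaxStart_cons (E : TECS) (n : NodeId) (U : List NodeId) :
    listMaxStart E (n :: U) = maxStart E n := rfl

theorem GoodList.listMaxStart_ext {E E' : TECS} (hE : Valid E) (h : Ext E E') {U : List NodeId}
    (hU : GoodList E U) : listMaxStart E' U = listMaxStart E U := by
  have hlt := fun n hn => hU.lt_size (n := n) hn
  obtain ⟨n₀, ns, rfl⟩ := hU.exists_eq_cons
  exact hE.maxStart_ext h (hlt _ (by simp))

/-- All but the first node of `U` have their maximum-starts in `K`. -/
def TailIn (E : TECS) (K : Set ℕ) (U : List NodeId) : Prop :=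
  ∀ n ∈ U.tail, maxStart E n ∈ K

theorem TailIn.ext {E E' : TECS} (hE : Valid E) (h : Ext E E') {U : List NodeId}
    (hU : GoodList E U) {K : Set ℕ} (hK : TailIn E K U) : TailIn E' K U := by
  intro n hn
  rw [hE.maxStart_ext h (hU.lt_size (List.mem_of_mem_tail hn))]
  exact hK n hn

/-- The maximum-starts of the nodes of a tail are distinct. -/
theorem GoodList.length_le {E : TECS} {U : List NodeId} (hU : GoodList E U) {K : Finset ℕ}
    (hK : TailIn E K U) : U.length ≤ K.card + 1 := by
  obtain ⟨n₀, ns, rfl⟩ := hU.exists_eq_cons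
  have hs := (goodList_cons.mp hU).1.sorted
  have hnd : (ns.map (maxStart E)).Nodup := by
    rw [List.Nodup, List.pairwise_map]
    exact hs.imp fun h => h.ne'
  have : (ns.map (maxStart E)).toFinset ⊆ K := by
    intro x hx
    obtain ⟨n, hn, rfl⟩ := List.mem_map.mp (List.mem_toFinset.mp hx)
    exact hK n hn
  have := Finset.card_le_card this
  rw [List.toFinset_card_of_nodup hnd, List.length_map] at this
  simpa using this

end TECS

section ListMethods

variable {Q : Type}

theorem wp_insertTail {n : NodeId} {m : ℕ} {ns : List NodeId} {s : Machine Q}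
    (hE : s.ecs.Valid) (hm : m = maxStart s.ecs n) (hn : Safe s.ecs n) (hns : GoodTail s.ecs ns)
    (hdisj : Disjoint (openEvents s.ecs n) (listEvents s.ecs ns)) :
    Wp (insertTail n m ns) s fun ns' s' =>
      Step (ns.length + 14) s s' ∧ GoodTail s'.ecs ns' ∧
      listEvents s'.ecs ns' = listEvents s.ecs ns ∪ openEvents s.ecs n ∧
      (∀ x ∈ ns', maxStart s'.ecs x = maxStart s.ecs n ∨
        ∃ y ∈ ns, maxStart s'.ecs x = maxStart s.ecs y) := by
  induction ns generalizing s with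
  | nil =>
    refine Wp.bind (wp_tick (wp_pure ⟨(Step.tick hE 1).mono (by simp),
      ⟨by simpa using hn, by simp, by simp⟩, ?_, by simp⟩))
    simp [listEvents_nil, listEvents_cons]
  | cons x xs ih =>
    have hx := hns.safe x (by simp)
    rw [listEvents_cons, Set.disjoint_union_right] at hdisj
    have hsort := List.pairwise_cons.mp hns.sorted
    have hdis := List.pairwise_cons.mp hns.disjoint
    have htl : GoodTail s.ecs xs := ⟨fun n hn => hns.safe n (by simp [hn]), hsort.2, hdis.2⟩
    refine Wp.bind (wp_readMax hE hx.lt_size ?_)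
    have hs := Step.tick hE 1
    split_ifs with h1 h2
    · refine Wp.bind ((wp_union (by exact hE) (by exact hx) (by exact hn)
        (by exact h1.trans hm) (by exact hdisj.1.symm)).mono ?_)
      rintro u s' ⟨hs', hsafe, hev, hmax⟩
      have hss := hs.trans hs' le_rfl
      have htl' := htl.ext hE hs'.ext
      have hev' := hE.listEvents_ext hs'.ext fun n hn => (htl.safe n hn).lt_size
      refine wp_pure ⟨hs.trans hs' (by simp only [List.length_cons]; omega),
        ⟨?_, ?_, ?_⟩, ?_, ?_⟩
      · intro y hy
        rcases List.mem_cons.mp hy with rfl | hy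
        · exact hsafe
        · exact htl'.safe y hy
      · refine List.pairwise_cons.mpr ⟨fun y hy => ?_, htl'.sorted⟩
        rw [hmax, hE.maxStart_ext hs'.ext (htl.safe y hy).lt_size]
        exact hsort.1 y hy
      · refine List.pairwise_cons.mpr ⟨?_, htl'.disjoint⟩
        rw [← disjoint_listEvents, hev, hev', Set.disjoint_union_left]
        exact ⟨disjoint_listEvents.mpr hdis.1, hdisj.2⟩
      · rw [listEvents_cons, hev, hev', listEvents_cons]
        ac_rfl
      · intro y hy
        rcases List.mem_cons.mp hy with rfl | hy
        · exact .inr ⟨x, by simp, hmax⟩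
        · exact .inr ⟨y, by simp [hy], hE.maxStart_ext hs'.ext (htl.safe y hy).lt_size⟩
    · refine wp_pure ⟨hs.mono (by simp only [List.length_cons]; omega),
        ⟨?_, ?_, ?_⟩, ?_, ?_⟩
      · intro y hy
        rcases List.mem_cons.mp hy with rfl | hy
        · exact hn
        · exact hns.safe y hy
      · refine List.pairwise_cons.mpr ⟨fun y hy => ?_, hns.sorted⟩
        rcases List.mem_cons.mp hy with rfl | hy
        · exact hm ▸ h2
        · exact (hsort.1 y hy).trans (hm ▸ h2)
      · refine List.pairwise_cons.mpr ⟨?_, hns.disjoint⟩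
        rw [← disjoint_listEvents, listEvents_cons, Set.disjoint_union_right]
        exact hdisj
      · rw [listEvents_cons, Set.union_comm]
      · intro y hy
        rcases List.mem_cons.mp hy with rfl | hy
        · exact .inl rfl
        · exact .inr ⟨y, hy, rfl⟩
    · refine Wp.bind ((ih (by exact hE) (by exact hm) (by exact hn) (by exact htl)
        (by exact hdisj.2)).mono ?_)
      rintro ys s' ⟨hs', hgood, hev, hmax⟩
      have hx' := hE.maxStart_ext hs'.ext hx.lt_size
      have hxe := hE.openEvents_ext hs'.ext hx.lt_size
      refine wp_pure ⟨hs.trans hs' (by simp only [List.length_cons]; omega),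
        ⟨?_, ?_, ?_⟩, ?_, ?_⟩
      · intro y hy
        rcases List.mem_cons.mp hy with rfl | hy
        · exact hx.ext hs'.ext
        · exact hgood.safe y hy
      · refine List.pairwise_cons.mpr ⟨fun y hy => ?_, hgood.sorted⟩
        rw [hx']
        rcases hmax y hy with h | ⟨z, hz, h⟩
        · rw [h, ← hm]; exact lt_of_le_of_ne (not_lt.mp h2) (Ne.symm h1)
        · rw [h]; exact hsort.1 z hz
      · refine List.pairwise_cons.mpr ⟨?_, hgood.disjoint⟩
        rw [← disjoint_listEvents, hev, hxe, Set.disjoint_union_right]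
        exact ⟨disjoint_listEvents.mpr hdis.1, hdisj.1.symm⟩
      · rw [listEvents_cons, hxe, hev, listEvents_cons, Set.union_assoc]
      · intro y hy
        rcases List.mem_cons.mp hy with rfl | hy
        · exact .inr ⟨y, by simp, hx'⟩
        · rcases hmax y hy with h | ⟨z, hz, h⟩
          · exact .inl h
          · exact .inr ⟨z, by simp [hz], h⟩

/-- The method `insert`. The set `K` controls the length of the list, see `GoodList.length_le`. -/
theorem wp_listInsert {n : NodeId} {U : List NodeId} {s : Machine Q} (hE : s.ecs.Valid)
    (hn : Safe s.ecs n) (hU : GoodList s.ecs U)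
    (hdisj : Disjoint (listEvents s.ecs U) (openEvents s.ecs n))
    (hle : maxStart s.ecs n ≤ listMaxStart s.ecs U) {K : Set ℕ} (hK : TailIn s.ecs K U)
    (hnK : maxStart s.ecs n ∈ K) :
    Wp (listInsert U n) s fun U' s' =>
      Step (U.length + 15) s s' ∧ GoodList s'.ecs U' ∧
      listEvents s'.ecs U' = listEvents s.ecs U ∪ openEvents s.ecs n ∧
      listMaxStart s'.ecs U' = listMaxStart s.ecs U ∧ TailIn s'.ecs K U' := by
  obtain ⟨n₀, ns, rfl⟩ := hU.exists_eq_cons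
  obtain ⟨h1, h2, h3, h4⟩ := goodList_cons.mp hU
  rw [listEvents_cons, Set.disjoint_union_left] at hdisj
  refine Wp.bind (wp_readMax hE h2.1 (Wp.bind (wp_readMax (by exact hE) (by exact hn.lt_size) ?_)))
  rw [listMaxStart_cons] at hle
  rw [if_pos (by exact hle)]
  have hs : Step 2 s { s with clock := s.clock + 1 + 1 } := Step.tick hE 2
  refine Wp.bind ((wp_insertTail (by exact hE) (by rfl) (by exact hn) (by exact h1)
    (by exact hdisj.2.symm)).mono ?_)
  rintro ns' s' ⟨hs', hgood, hev, hmax⟩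
  have he := hE.openEvents_ext hs'.ext h2.1
  have hm := hE.maxStart_ext hs'.ext h2.1
  refine wp_pure ⟨hs.trans hs' (by simp only [List.length_cons]; omega),
    goodList_cons.mpr ⟨hgood, h2.ext hs'.ext, ?_, ?_⟩, ?_, ?_, ?_⟩
  · intro y hy
    rw [hm]
    rcases hmax y hy with h | ⟨z, hz, h⟩
    · exact h.trans_le hle
    · exact h.trans_le (h3 z hz)
  · rw [hev, he, Set.disjoint_union_right]
    exact ⟨h4, hdisj.1⟩
  · rw [listEvents_cons, hev, he, listEvents_cons, Set.union_assoc]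
  · exact hm
  · intro y hy
    rcases hmax y hy with h | ⟨z, hz, h⟩
    · exact h ▸ hnK
    · exact h ▸ hK z hz

/-- Merging a list of safe nodes, sorted by maximum-start: as the nodes have output-depth at most
`1`, the result has output-depth at most `2`. -/
theorem wp_listMerge_of_safe {n : NodeId} {ns : List NodeId} {s : Machine Q} (hE : s.ecs.Valid)
    (hsafe : ∀ x ∈ n :: ns, Safe s.ecs x)
    (hsort : (n :: ns).Pairwise fun a b => maxStart s.ecs b ≤ maxStart s.ecs a)
    (hdisj : (n :: ns).Pairwise fun a b => Disjoint (openEvents s.ecs a) (openEvents s.ecs b)) :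
    Wp (listMerge (n :: ns)) s fun u s' => Step (4 * ns.length + 1) s s' ∧
      openEvents s'.ecs u = listEvents s.ecs (n :: ns) ∧
      maxStart s'.ecs u = maxStart s.ecs n ∧ u < s'.ecs.size ∧
      (ns = [] → u = n) ∧
      (∀ n' ns', ns = n' :: ns' → ∃ r x, s'.ecs[u]? = some (.union n r x) ∧
        ∃ d ≤ 2, ODepth s'.ecs r d) ∧
      ∃ d ≤ 2, ODepth s'.ecs u d := by
  induction ns generalizing n s with
  | nil =>
    obtain ⟨d, hd, hd'⟩ := (hsafe n (by simp)).exists_oDepth_le_one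
    exact Wp.bind (wp_tick (wp_pure ⟨Step.tick hE 1, by simp [listEvents_cons, listEvents_nil],
      rfl, (hsafe n (by simp)).lt_size, fun _ => rfl, by simp, d, by omega, hd'⟩))
  | cons n' ns ih =>
    rw [List.pairwise_cons] at hsort hdisj
    refine Wp.bind (wp_tick (Wp.bind ((ih (by exact hE)
      (by exact fun x hx => hsafe x (List.mem_cons_of_mem _ hx))
      (by exact hsort.2) (by exact hdisj.2)).mono ?_)))
    rintro u s' ⟨hs, hev, hmax, hlt, -, -, d, hd, hd'⟩
    have hn := hsafe n (by simp)
    have hm := hE.maxStart_ext hs.ext hn.lt_size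
    have he := hE.openEvents_ext hs.ext hn.lt_size
    obtain ⟨d₀, hd₀, hd₀'⟩ := hn.exists_oDepth_le_one
    refine (wp_newUnion (d := d₀) hs.valid (hn.ext hs.ext).lt_size hlt ?_ (by omega)
      (hd₀'.ext hs.ext) ?_).mono ?_
    · rw [hm, hmax]
      exact hsort.1 n' (by simp)
    · rw [he, hev]
      exact disjoint_listEvents.mpr hdisj.1
    rintro v s'' ⟨hs', ⟨x, hx⟩, hev', hmax', ho⟩
    refine ⟨((Step.tick hE 1).trans hs le_rfl).trans hs' (by simp only [List.length_cons]; omega),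
      ?_, hmax'.trans hm, lt_size_of_get hx, by simp, ?_, d₀ + 1, by omega, ho⟩
    · rw [hev', he, hev, listEvents_cons s.ecs n]
    · exact fun _ _ _ => ⟨u, x, hx, d, hd, hd'.ext hs'.ext⟩

/-- The method `merge`. The first node being a non-union node, the result is safe. -/
theorem wp_listMerge {U : List NodeId} {s : Machine Q} (hE : s.ecs.Valid)
    (hU : GoodList s.ecs U) :
    Wp (listMerge U) s fun u s' => Step (4 * U.length) s s' ∧ Safe s'.ecs u ∧
      openEvents s'.ecs u = listEvents s.ecs U ∧
      maxStart s'.ecs u = listMaxStart s.ecs U := by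
  have hdis := hU.disjoint
  have hsafe : ∀ n ∈ U, Safe s.ecs n := by
    obtain ⟨n₀, ns, rfl⟩ := hU.exists_eq_cons
    exact hU.isUnionList.1
  obtain ⟨n₀, ns, rfl⟩ := hU.exists_eq_cons
  obtain ⟨h1, h2, h3, -⟩ := goodList_cons.mp hU
  refine (wp_listMerge_of_safe hE hsafe (List.pairwise_cons.mpr ⟨h3, h1.sorted.imp le_of_lt⟩)
    hdis).mono ?_
  rintro u s' ⟨hs, hev, hmax, hlt, hnil, hcons, -⟩
  refine ⟨hs.mono (by simp only [List.length_cons]; omega), ?_, hev, hmax⟩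
  cases ns with
  | nil => exact .inl (hnil rfl ▸ h2.ext hs.ext)
  | cons n' ns' =>
    obtain ⟨r, x, hx, d, hd, hd'⟩ := hcons n' ns' rfl
    exact safe_of_union hx (h2.ext hs.ext) hd hd'

end ListMethods

/-! ### Runs as open complex events -/

/-- The effect of reading position `j` with a given action on an open complex event. -/
def Action.apply (j : ℕ) (o : ℕ × Finset ℕ) : Action → ℕ × Finset ℕ
  | .mark => (o.1, insert j o.2)
  | .unmark => o

theorem Action.apply_inj {j : ℕ} {o o' : ℕ × Finset ℕ} (ho : ∀ d ∈ o.2, d < j)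
    (ho' : ∀ d ∈ o'.2, d < j) {a a' : Action} (h : a.apply j o = a'.apply j o') :
    a = a' ∧ o = o' := by
  obtain ⟨i, D⟩ := o
  obtain ⟨i', D'⟩ := o'
  have hD : j ∉ D := fun h => (ho j h).false
  have hD' : j ∉ D' := fun h => (ho' j h).false
  cases a <;> cases a' <;> simp only [Action.apply, Prod.mk.injEq] at h
  · obtain ⟨rfl, h⟩ := h
    have := congrArg (fun s => Finset.erase s j) h
    simp only [Finset.erase_insert hD, Finset.erase_insert hD'] at this
    exact ⟨rfl, by rw [this]⟩
  · exact (hD' (h.2 ▸ Finset.mem_insert_self _ _)).elim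
  · exact (hD (h.2 ▸ Finset.mem_insert_self _ _)).elim
  · exact ⟨rfl, by rw [h.1, h.2]⟩

namespace CEA

variable {Tup : Type*} {Q : Type}

/-- The open complex events of `q` after the tuple `t` has been read at position `j` by a transition
from `p`, if those of `p` before were the elements of `O`. -/
def moves (A : CEA Tup Q) (t : Tup) (j : ℕ) (p : Q) (O : Set (ℕ × Finset ℕ)) (q : Q) :
    Set (ℕ × Finset ℕ) :=
  {o | ∃ e ∈ A.Δ, e.source = p ∧ t ∈ e.pred ∧ e.target = q ∧ ∃ o' ∈ O, o = e.action.apply j o'}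

/-- The open complex events `(i, D)` of the runs that start at a position `i < n`, read the tuples
up to position `n - 1`, and end in the given state. -/
def openRuns (A : CEA Tup Q) (S : Stream'.Seq Tup) : ℕ → Q → Set (ℕ × Finset ℕ)
  | 0, _ => ∅
  | n + 1, q => {o | ∃ t, S.get? n = some t ∧
      ∃ p, o ∈ A.moves t n p (openRuns A S n p ∪ {o | p = A.q₀ ∧ o = (n, ∅)}) q}

/-- The open complex events of the runs that can be continued at position `n`, including the empty
run, which has not left the initial state. -/
def activeRuns (A : CEA Tup Q) (S : Stream'.Seq Tup) (n : ℕ) (p : Q) : Set (ℕ × Finset ℕ) :=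
  A.openRuns S n p ∪ {o | p = A.q₀ ∧ o = (n, ∅)}

variable {A : CEA Tup Q} {S : Stream'.Seq Tup}

theorem openRuns_succ {n : ℕ} {t : Tup} (ht : S.get? n = some t) (q : Q) :
    A.openRuns S (n + 1) q = {o | ∃ p, o ∈ A.moves t n p (A.activeRuns S n p) q} := by
  ext o
  constructor
  · rintro ⟨t', ht', h⟩
    rw [ht] at ht'
    cases ht'
    exact h
  · exact fun h => ⟨t, ht, h⟩

theorem moves_bound {t : Tup} {n : ℕ} {p q : Q} {O : Set (ℕ × Finset ℕ)}
    (hO : ∀ o ∈ O, o.1 ≤ n ∧ ∀ d ∈ o.2, o.1 ≤ d ∧ d < n) {o : ℕ × Finset ℕ}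
    (ho : o ∈ A.moves t n p O q) : o.1 < n + 1 ∧ ∀ d ∈ o.2, o.1 ≤ d ∧ d < n + 1 := by
  obtain ⟨e, -, -, -, -, o', ho', rfl⟩ := ho
  obtain ⟨h1, h2⟩ := hO o' ho'
  cases e.action
  · refine ⟨by simp only [Action.apply]; omega, fun d hd => ?_⟩
    rcases Finset.mem_insert.mp hd with rfl | hd
    · exact ⟨h1, by omega⟩
    · exact ⟨(h2 d hd).1, by have := (h2 d hd).2; omega⟩
  · exact ⟨by simp only [Action.apply]; omega, fun d hd => ⟨(h2 d hd).1, by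
      have := (h2 d hd).2; omega⟩⟩

theorem openRuns_bound {n : ℕ} {q : Q} {o : ℕ × Finset ℕ} (ho : o ∈ A.openRuns S n q) :
    o.1 < n ∧ ∀ d ∈ o.2, o.1 ≤ d ∧ d < n := by
  induction n generalizing q o with
  | zero => exact ho.elim
  | succ n ih =>
    obtain ⟨t, -, p, h⟩ := ho
    refine moves_bound ?_ h
    rintro o (ho | ⟨-, rfl⟩)
    · exact ⟨(ih ho).1.le, (ih ho).2⟩
    · simp

theorem activeRuns_bound {n : ℕ} {q : Q} {o : ℕ × Finset ℕ} (ho : o ∈ A.activeRuns S n q) :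
    o.1 ≤ n ∧ ∀ d ∈ o.2, o.1 ≤ d ∧ d < n := by
  rcases ho with ho | ⟨-, rfl⟩
  · exact ⟨(openRuns_bound ho).1.le, (openRuns_bound ho).2⟩
  · simp

theorem openRuns_target {n : ℕ} {q : Q} {o : ℕ × Finset ℕ} (ho : o ∈ A.openRuns S n q) :
    ∃ e ∈ A.Δ, e.target = q := by
  cases n with
  | zero => exact ho.elim
  | succ n =>
    obtain ⟨t, -, p, e, he, -, -, h, -⟩ := ho
    exact ⟨e, he, h⟩

theorem activeRuns_of_ne {n : ℕ} {q : Q} (hq : q ≠ A.q₀) :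
    A.activeRuns S n q = A.openRuns S n q := by
  ext o
  simp [activeRuns, hq]

theorem activeRuns_init (n : ℕ) : A.activeRuns S n A.q₀ = {(n, ∅)} := by
  ext o
  constructor
  · rintro (ho | ⟨-, rfl⟩)
    · obtain ⟨e, he, h⟩ := openRuns_target ho
      exact (A.target_ne e he h).elim
    · rfl
  · rintro rfl
    exact .inr ⟨rfl, rfl⟩

/-- In an I/O-deterministic automaton, an open complex event determines the last transition, if it
determines the state before. -/
theorem moves_unique (hA : A.IODeterministic) {n : ℕ} {t : Tup}
    (hu : ∀ p p' o, o ∈ A.activeRuns S n p → o ∈ A.activeRuns S n p' → p = p') {p p' q q' : Q}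
    {o : ℕ × Finset ℕ} (h : o ∈ A.moves t n p (A.activeRuns S n p) q)
    (h' : o ∈ A.moves t n p' (A.activeRuns S n p') q') : p = p' ∧ q = q' := by
  obtain ⟨e, he, rfl, het, rfl, o₁, ho₁, rfl⟩ := h
  obtain ⟨e', he', rfl, het', rfl, o₂, ho₂, heq⟩ := h'
  obtain ⟨ha, rfl⟩ := Action.apply_inj (fun d hd => ((activeRuns_bound ho₁).2 d hd).2)
    (fun d hd => ((activeRuns_bound ho₂).2 d hd).2) heq
  have hs := hu _ _ _ ho₁ ho₂
  by_cases hee : e = e'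
  · subst hee; exact ⟨rfl, rfl⟩
  · exact (hA e he e' he' hee hs ⟨t, het, het'⟩ ha).elim

theorem activeRuns_unique (hA : A.IODeterministic) {n : ℕ} {p p' : Q} {o : ℕ × Finset ℕ}
    (h : o ∈ A.activeRuns S n p) (h' : o ∈ A.activeRuns S n p') : p = p' := by
  induction n generalizing p p' o with
  | zero =>
    rcases h with h | ⟨rfl, -⟩
    · exact h.elim
    rcases h' with h' | ⟨rfl, -⟩
    · exact h'.elim
    · rfl
  | succ n ih =>
    rcases h with h | ⟨rfl, rfl⟩ <;> rcases h' with h' | ⟨rfl, h'⟩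
    · obtain ⟨t, ht, _, h⟩ := h
      obtain ⟨t', ht', _, h'⟩ := h'
      rw [ht] at ht'
      cases ht'
      exact (moves_unique hA (fun _ _ _ => ih) h h').2
    · rw [h'] at h
      exact absurd (openRuns_bound h).1 (lt_irrefl _)
    · exact absurd (openRuns_bound h').1 (lt_irrefl _)
    · rfl

theorem disjoint_moves (hA : A.IODeterministic) {n : ℕ} {t : Tup} {p p' : Q} (hp : p ≠ p')
    (q : Q) : Disjoint (A.moves t n p (A.activeRuns S n p) q)
      (A.moves t n p' (A.activeRuns S n p') q) := by
  rw [Set.disjoint_left]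
  exact fun o h h' => hp (moves_unique hA (fun _ _ _ => activeRuns_unique hA) h h').1

theorem disjoint_openRuns (hA : A.IODeterministic) {n : ℕ} {p p' : Q} (hp : p ≠ p') :
    Disjoint (A.openRuns S n p) (A.openRuns S n p') := by
  rw [Set.disjoint_left]
  exact fun o h h' => hp (activeRuns_unique hA (.inl h) (.inl h'))

/-- The start and the marked positions of a run that is continued by one transition. -/
theorem filter_mark_succ {i j : ℕ} (hij : i ≤ j + 1) {ρ ρ' : ℕ → Transition Tup Q}
    (hρ : ∀ k ∈ Finset.Icc i j, ρ' k = ρ k) :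
    (i, (Finset.Icc i (j + 1)).filter fun k => (ρ' k).action = Action.mark) =
      (ρ' (j + 1)).action.apply (j + 1)
        (i, (Finset.Icc i j).filter fun k => (ρ k).action = Action.mark) := by
  have hI : Finset.Icc i (j + 1) = insert (j + 1) (Finset.Icc i j) := by
    ext k; simp only [Finset.mem_Icc, Finset.mem_insert]; omega
  have hf : ((Finset.Icc i j).filter fun k => (ρ' k).action = Action.mark) =
      (Finset.Icc i j).filter fun k => (ρ k).action = Action.mark :=
    Finset.filter_congr fun k hk => by rw [hρ k hk]
  rw [hI, Finset.filter_insert, hf]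
  cases h : (ρ' (j + 1)).action <;> simp [Action.apply]

theorem mem_openRuns_iff {j : ℕ} {q : Q} {i : ℕ} {D : Finset ℕ} :
    (i, D) ∈ A.openRuns S (j + 1) q ↔ ∃ ρ, A.IsRun S i j ρ ∧ (ρ j).target = q ∧
      D = (Finset.Icc i j).filter fun k => (ρ k).action = Action.mark := by
  have hsingle : ∀ (j : ℕ) (ρ : ℕ → Transition Tup Q),
      ((j, (Finset.Icc j j).filter fun k => (ρ k).action = Action.mark) : ℕ × Finset ℕ) =
        (ρ j).action.apply j (j, ∅) := by
    intro j ρ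
    rw [Finset.Icc_self, Finset.filter_singleton]
    cases (ρ j).action <;> simp [Action.apply]
  induction j generalizing q i D with
  | zero =>
    constructor
    · rintro ⟨t, ht, p, e, he, rfl, het, rfl, o', ho' | ⟨hq, rfl⟩, h⟩
      · exact ho'.elim
      have hi : i = 0 := by
        have := congrArg Prod.fst h
        cases ha : e.action <;> simpa [ha, Action.apply] using this
      subst hi
      refine ⟨fun _ => e, ⟨le_rfl, hq, ?_, by simp⟩, rfl, ?_⟩
      · intro k hk
        obtain rfl : k = 0 := by simpa using hk
        exact ⟨he, t, ht, het⟩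
      · exact congrArg Prod.snd (h.trans (hsingle 0 fun _ => e).symm)
    · rintro ⟨ρ, hρ, rfl, rfl⟩
      obtain rfl : i = 0 := Nat.le_zero.mp hρ.le
      obtain ⟨he, t, ht, het⟩ := hρ.step 0 (by simp)
      exact ⟨t, ht, _, ρ 0, he, rfl, het, rfl, _, .inr ⟨hρ.init, rfl⟩, hsingle 0 ρ⟩
  | succ j ih =>
    constructor
    · rintro ⟨t, ht, p, e, he, rfl, het, rfl, ⟨i', D'⟩, ho' | ⟨hq, ho'⟩, h⟩
      · obtain ⟨ρ, hρ, hq, rfl⟩ := ih.mp ho'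
        have hi : i = i' := by
          have := congrArg Prod.fst h
          cases ha : e.action <;> simpa [ha, Action.apply] using this
        subst hi
        have hij := hρ.le
        have hup : ∀ k ∈ Finset.Icc i j, Function.update ρ (j + 1) e k = ρ k := by
          intro k hk
          rw [Finset.mem_Icc] at hk
          exact Function.update_of_ne (by omega) _ _
        have hnew : Function.update ρ (j + 1) e (j + 1) = e := Function.update_self ..
        refine ⟨Function.update ρ (j + 1) e, ⟨by omega, ?_, ?_, ?_⟩, by rw [hnew], ?_⟩
        · rw [hup i (by simpa using hij)]
          exact hρ.init
        · intro k hk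
          by_cases hkj : k = j + 1
          · subst hkj
            rw [hnew]
            exact ⟨he, t, ht, het⟩
          · have hk' : k ∈ Finset.Icc i j := by
              rw [Finset.mem_Icc] at hk ⊢; omega
            rw [hup k hk']
            exact hρ.step k hk'
        · intro k hk
          rw [Finset.mem_Ico] at hk
          rw [hup k (by rw [Finset.mem_Icc]; omega)]
          by_cases hkj : k = j
          · subst hkj
            rw [hnew]
            exact hq
          · rw [hup (k + 1) (by rw [Finset.mem_Icc]; omega)]
            exact hρ.link k (by rw [Finset.mem_Ico]; omega)
        · have := filter_mark_succ (i := i) (by omega) hup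
          rw [hnew] at this
          exact congrArg Prod.snd (h.trans this.symm)
      · cases ho'
        have hi : i = j + 1 := by
          have := congrArg Prod.fst h
          cases ha : e.action <;> simpa [ha, Action.apply] using this
        subst hi
        refine ⟨fun _ => e, ⟨le_rfl, hq, ?_, by simp⟩, rfl, ?_⟩
        · intro k hk
          obtain rfl : k = j + 1 := by simpa using hk
          exact ⟨he, t, ht, het⟩
        · exact congrArg Prod.snd (h.trans (hsingle (j + 1) fun _ => e).symm)
    · rintro ⟨ρ, hρ, rfl, rfl⟩
      have hij := hρ.le
      obtain ⟨he, t, ht, het⟩ := hρ.step (j + 1) (by simpa using hij)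
      by_cases hi : i = j + 1
      · subst hi
        exact ⟨t, ht, _, ρ (j + 1), he, rfl, het, rfl, _, .inr ⟨hρ.init, rfl⟩, hsingle _ ρ⟩
      · refine ⟨t, ht, _, ρ (j + 1), he, rfl, het, rfl, _, .inl (ih.mpr ⟨ρ, ⟨by omega, hρ.init,
          fun k hk => hρ.step k ?_, fun k hk => hρ.link k ?_⟩, hρ.link j ?_, rfl⟩),
          filter_mark_succ (by omega) fun _ _ => rfl⟩
        · rw [Finset.mem_Icc] at hk ⊢; omega
        · rw [Finset.mem_Ico] at hk ⊢; omega
        · rw [Finset.mem_Ico]; omega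

theorem mem_semAt_iff {ε j : ℕ} {C : ComplexEvent} :
    C ∈ A.semAt S ε j ↔ C.finish = j ∧ j - ε ≤ C.start ∧
      ∃ q ∈ A.F, (C.start, C.data) ∈ A.openRuns S (j + 1) q := by
  constructor
  · rintro ⟨⟨i, j', ρ, hρ, hF, rfl⟩, hε, hj⟩
    have hj : j' = j := hj
    subst hj
    have hε : j' - i ≤ ε := hε
    exact ⟨rfl, show j' - ε ≤ i by omega, _, hF, mem_openRuns_iff.mpr ⟨ρ, hρ, rfl, rfl⟩⟩
  · rintro ⟨hj, hε, q, hq, h⟩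
    subst hj
    obtain ⟨ρ, hρ, rfl, hD⟩ := mem_openRuns_iff.mp h
    refine ⟨⟨_, _, ρ, hρ, hq, ?_⟩, by omega, rfl⟩
    cases C
    simp_all [complexEvent]

end CEA

/-! ### Hash tables -/

namespace Table

variable {Q : Type} [DecidableEq Q]

theorem set_of_find?_eq_some {T : Table Q} {q : Q} {V : List NodeId} (h : T.find? q = some V) :
    ∃ T₁ T₂ : List (Q × List NodeId), T = T₁ ++ (q, V) :: T₂ ∧
      ∀ V', T.set q V' = T₁ ++ (q, V') :: T₂ := by
  induction T with
  | nil => simp [find?] at h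
  | cons x T ih =>
    obtain ⟨p, U⟩ := x
    rw [find?] at h
    split_ifs at h with hp
    · cases h
      subst hp
      exact ⟨[], T, rfl, fun V' => by simp [set]⟩
    · obtain ⟨T₁, T₂, rfl, h2⟩ := ih h
      exact ⟨(p, U) :: T₁, T₂, rfl, fun V' => by simp [set, hp, h2]⟩

theorem set_of_find?_eq_none {T : Table Q} {q : Q} (h : T.find? q = none) :
    q ∉ T.map Prod.fst ∧ ∀ V, T.set q V = T ++ [(q, V)] := by
  induction T with
  | nil => simp [set]
  | cons x T ih =>
    obtain ⟨p, U⟩ := x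
    rw [find?] at h
    split_ifs at h with hp
    obtain ⟨h1, h2⟩ := ih h
    refine ⟨?_, fun V => by simp [set, hp, h2]⟩
    rw [List.map_cons, List.mem_cons, not_or]
    exact ⟨fun h => hp h.symm, h1⟩

end Table

section TableInvariant

variable {Tup : Type*} {Q : Type}

/-- The open complex events stored for the key `q`. -/
def tableEvents (E : TECS) (T : Table Q) (q : Q) : Set (ℕ × Finset ℕ) :=
  {o | ∃ U, (q, U) ∈ T ∧ o ∈ listEvents E U}

/-- The invariant of a hash table: its values are union-lists, sorted by the maximum-start of their
first nodes. These maximum-starts belong to `H`, and a list whose first node has maximum-start `h`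
has all other maximum-starts in `K h`. Below, `K h` contains all elements of `H` up to `h`, so that
a node whose maximum-start is in `H` may be inserted, and it has at most `|Q|` elements, which bounds
the length of the lists. -/
structure GoodTable (A : CEA Tup Q) (E : TECS) (H : Set ℕ) (K : ℕ → Finset ℕ) (T : Table Q) :
    Prop where
  nodup : (T.map Prod.fst).Nodup
  target : ∀ p ∈ T.map Prod.fst, ∃ e ∈ A.Δ, e.target = p
  good : ∀ x ∈ T, GoodList E x.2
  sorted : (T.map fun x => listMaxStart E x.2).Pairwise (· ≥ ·)
  heads : ∀ h ∈ T.map fun x => listMaxStart E x.2, h ∈ H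
  tails : ∀ x ∈ T, TailIn E (K (listMaxStart E x.2)) x.2

variable {A : CEA Tup Q} {H : Set ℕ} {K : ℕ → Finset ℕ}

theorem GoodTable.map_ext {E E' : TECS} (hE : E.Valid) (h : Ext E E') {T : Table Q}
    (hT : ∀ x ∈ T, GoodList E x.2) :
    (T.map fun x => listMaxStart E' x.2) = T.map fun x => listMaxStart E x.2 :=
  List.map_congr_left fun x hx => (hT x hx).listMaxStart_ext hE h

theorem GoodTable.ext {E E' : TECS} (hE : E.Valid) (h : Ext E E') {T : Table Q}
    (hT : GoodTable A E H K T) : GoodTable A E' H K T := by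
  have hm := GoodTable.map_ext hE h hT.good
  refine ⟨hT.nodup, hT.target, fun x hx => (hT.good x hx).ext hE h, hm ▸ hT.sorted,
    hm ▸ hT.heads, fun x hx => ?_⟩
  rw [(hT.good x hx).listMaxStart_ext hE h]
  exact (hT.tails x hx).ext hE h (hT.good x hx)

theorem GoodTable.tableEvents_ext {E E' : TECS} (hE : E.Valid) (h : Ext E E') {T : Table Q}
    (hT : ∀ x ∈ T, GoodList E x.2) (q : Q) : tableEvents E' T q = tableEvents E T q := by
  ext o
  constructor <;> rintro ⟨U, hU, ho⟩ <;> refine ⟨U, hU, ?_⟩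
  · rwa [hE.listEvents_ext h fun n hn => (hT _ hU).lt_size hn] at ho
  · rwa [hE.listEvents_ext h fun n hn => (hT _ hU).lt_size hn]

theorem GoodTable.of_cons {E : TECS} {x : Q × List NodeId} {T : Table Q}
    (hT : GoodTable A E H K (x :: T)) : GoodTable A E H K T :=
  ⟨(List.nodup_cons.mp hT.nodup).2, fun p hp => hT.target p (List.mem_cons_of_mem _ hp),
    fun y hy => hT.good y (List.mem_cons_of_mem _ hy), (List.pairwise_cons.mp hT.sorted).2,
    fun p hp => hT.heads p (List.mem_cons_of_mem _ hp),
    fun y hy => hT.tails y (List.mem_cons_of_mem _ hy)⟩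

/-- Appending a new key whose list has a first node of smallest maximum-start. -/
theorem GoodTable.append {E : TECS} {T : Table Q} (hT : GoodTable A E H K T) {q : Q}
    {U : List NodeId} (hq : q ∉ T.map Prod.fst) (ht : ∃ e ∈ A.Δ, e.target = q)
    (hU : GoodList E U) (hle : ∀ x ∈ T, listMaxStart E U ≤ listMaxStart E x.2)
    (hH : listMaxStart E U ∈ H) (hK : TailIn E (K (listMaxStart E U)) U) :
    GoodTable A E H K (T ++ [(q, U)]) := by
  refine ⟨?_, ?_, ?_, ?_, ?_, ?_⟩
  · rw [List.map_append, List.nodup_append]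
    refine ⟨hT.nodup, by simp, ?_⟩
    rintro a ha b hb rfl
    simp only [List.map_cons, List.map_nil, List.mem_singleton] at hb
    exact hq (hb ▸ ha)
  · intro p hp
    rw [List.map_append, List.mem_append] at hp
    rcases hp with hp | hp
    · exact hT.target p hp
    · simp only [List.map_cons, List.map_nil, List.mem_singleton] at hp
      exact hp ▸ ht
  · intro x hx
    rcases List.mem_append.mp hx with hx | hx
    · exact hT.good x hx
    · rw [List.mem_singleton] at hx
      exact hx ▸ hU
  · rw [List.map_append, List.pairwise_append]
    refine ⟨hT.sorted, by simp, fun a ha b hb => ?_⟩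
    obtain ⟨x, hx, rfl⟩ := List.mem_map.mp ha
    simp only [List.map_cons, List.map_nil, List.mem_singleton] at hb
    exact hb ▸ hle x hx
  · intro h hh
    rw [List.map_append, List.mem_append] at hh
    rcases hh with hh | hh
    · exact hT.heads h hh
    · simp only [List.map_cons, List.map_nil, List.mem_singleton] at hh
      exact hh ▸ hH
  · intro x hx
    rcases List.mem_append.mp hx with hx | hx
    · exact hT.tails x hx
    · rw [List.mem_singleton] at hx
      exact hx ▸ hK

/-- Replacing the list of a key by one whose first node has the same maximum-start. -/
theorem GoodTable.replace {E : TECS} {T₁ T₂ : List (Q × List NodeId)} {q : Q} {V V' : List NodeId}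
    (hT : GoodTable A E H K (T₁ ++ (q, V) :: T₂)) (hV' : GoodList E V')
    (hm : listMaxStart E V' = listMaxStart E V) (hK : TailIn E (K (listMaxStart E V)) V') :
    GoodTable A E H K (T₁ ++ (q, V') :: T₂) := by
  have hk : ((T₁ ++ (q, V') :: T₂).map Prod.fst) = (T₁ ++ (q, V) :: T₂).map Prod.fst := by simp
  have hl : ((T₁ ++ (q, V') :: T₂).map fun x => listMaxStart E x.2) =
      (T₁ ++ (q, V) :: T₂).map fun x => listMaxStart E x.2 := by simp [hm]
  have hmem : ∀ x ∈ T₁ ++ (q, V') :: T₂, x ∈ T₁ ++ (q, V) :: T₂ ∨ x = (q, V') := by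
    intro x hx
    simp only [List.mem_append, List.mem_cons] at hx ⊢
    tauto
  refine ⟨hk ▸ hT.nodup, hk ▸ hT.target, fun x hx => ?_, hl ▸ hT.sorted, hl ▸ hT.heads,
    fun x hx => ?_⟩
  · rcases hmem x hx with hx | rfl
    · exact hT.good x hx
    · exact hV'
  · rcases hmem x hx with hx | rfl
    · exact hT.tails x hx
    · exact hm.symm ▸ hK

theorem tableEvents_append {E : TECS} (T₁ T₂ : List (Q × List NodeId)) (q : Q) :
    tableEvents E (T₁ ++ T₂) q = tableEvents E T₁ q ∪ tableEvents E T₂ q := by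
  ext o
  simp only [tableEvents, List.mem_append, Set.mem_ofPred_eq, Set.mem_union]
  constructor
  · rintro ⟨U, hU | hU, ho⟩
    · exact .inl ⟨U, hU, ho⟩
    · exact .inr ⟨U, hU, ho⟩
  · rintro (⟨U, hU, ho⟩ | ⟨U, hU, ho⟩)
    · exact ⟨U, .inl hU, ho⟩
    · exact ⟨U, .inr hU, ho⟩

theorem tableEvents_cons {E : TECS} (p : Q) (U : List NodeId) (T : List (Q × List NodeId))
    (q : Q) : tableEvents E ((p, U) :: T) q = {o | q = p ∧ o ∈ listEvents E U} ∪
      tableEvents E T q := by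
  ext o
  simp only [tableEvents, List.mem_cons, Set.mem_ofPred_eq, Set.mem_union, Prod.mk.injEq]
  constructor
  · rintro ⟨V, ⟨rfl, rfl⟩ | hV, ho⟩
    · exact .inl ⟨rfl, ho⟩
    · exact .inr ⟨V, hV, ho⟩
  · rintro (⟨rfl, ho⟩ | ⟨V, hV, ho⟩)
    · exact ⟨U, .inl ⟨rfl, rfl⟩, ho⟩
    · exact ⟨V, .inr hV, ho⟩

theorem tableEvents_nil {E : TECS} (q : Q) : tableEvents E ([] : Table Q) q = ∅ := by
  ext o
  simp [tableEvents]

theorem GoodTable.tableEvents_eq {E : TECS} {T : Table Q} (hT : (T.map Prod.fst).Nodup) {q : Q}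
    {U : List NodeId} (h : (q, U) ∈ T) : tableEvents E T q = listEvents E U := by
  ext o
  constructor
  · rintro ⟨V, hV, ho⟩
    have heq : U = V := congrArg Prod.snd (List.inj_on_of_nodup_map hT h hV rfl)
    rwa [heq]
  · exact fun ho => ⟨U, h, ho⟩

/-! ### The update -/

/-- `Frame k s s'`: the machine has appended cells to its memory and has made at most `k` steps; the
table `T` and the output have not changed. -/
structure Frame (k : ℕ) (s s' : Machine Q) : Prop where
  ext : Ext s.ecs s'.ecs
  T : s'.T = s.T
  log : s'.log = s.log
  clock : s'.clock ≤ s.clock + k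

theorem Step.frame {k : ℕ} {s s' : Machine Q} (h : Step k s s') : Frame k s s' :=
  ⟨h.ext, h.T, h.log, h.clock⟩

theorem Frame.tick (k : ℕ) (s : Machine Q) : Frame k s { s with clock := s.clock + k } :=
  ⟨.refl _, rfl, rfl, le_rfl⟩

theorem Frame.trans {s₁ s₂ s₃ : Machine Q} {k k' k'' : ℕ} (h : Frame k s₁ s₂)
    (h' : Frame k' s₂ s₃) (hk : k + k' ≤ k'') : Frame k'' s₁ s₃ :=
  ⟨h.ext.trans h'.ext, h'.T.trans h.T, h'.log.trans h.log, by
    have := h.clock; have := h'.clock; omega⟩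

/-- The invariant of the update: the table `T'` represents the sets `R q`, and the first nodes of
its lists have maximum-start at least `h`. -/
structure Filled (A : CEA Tup Q) (H : Set ℕ) (K : ℕ → Finset ℕ) (R : Q → Set (ℕ × Finset ℕ))
    (h : ℕ) (s : Machine Q) : Prop where
  valid : s.ecs.Valid
  table : GoodTable A s.ecs H K s.T'
  events : ∀ q, tableEvents s.ecs s.T' q = R q
  lower : ∀ x ∈ s.T', h ≤ listMaxStart s.ecs x.2

variable {R : Q → Set (ℕ × Finset ℕ)} {h : ℕ}

theorem Filled.step {k : ℕ} {s s' : Machine Q} (hs : Filled A H K R h s) (hss : Step k s s') :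
    Filled A H K R h s' := by
  refine ⟨hss.valid, ?_, ?_, ?_⟩ <;> rw [hss.T']
  · exact hs.table.ext hs.valid hss.ext
  · intro q
    rw [GoodTable.tableEvents_ext hs.valid hss.ext hs.table.good]
    exact hs.events q
  · intro x hx
    rw [(hs.table.good x hx).listMaxStart_ext hs.valid hss.ext]
    exact hs.lower x hx

theorem Filled.congr {R' : Q → Set (ℕ × Finset ℕ)} {h' : ℕ} {s : Machine Q}
    (hs : Filled A H K R h s) (hR : ∀ q, R q = R' q) (hh : h' ≤ h) : Filled A H K R' h' s :=
  ⟨hs.valid, hs.table, fun q => (hs.events q).trans (hR q), fun x hx => hh.trans (hs.lower x hx)⟩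

variable {N : ℕ}

/-- Adding to the list of `q` a node, or a list, that represents the set `X`. -/
theorem wp_add [DecidableEq Q] (hHK : ∀ h ∈ H, ∀ h' ∈ H, h ≤ h' → h ∈ K h')
    (hN : ∀ h, (K h).card ≤ N)
    {q : Q} {n : NodeId} {U : List NodeId} {X : Set (ℕ × Finset ℕ)} {s : Machine Q}
    (hs : Filled A H K R h s) (hq : ∃ e ∈ A.Δ, e.target = q) (hn : Safe s.ecs n)
    (hU : GoodList s.ecs U) (hnX : openEvents s.ecs n = X) (hUX : listEvents s.ecs U = X)
    (hnh : maxStart s.ecs n = h) (hUh : listMaxStart s.ecs U = h) (hH : h ∈ H)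
    (hK : TailIn s.ecs (K h) U) (hdisj : Disjoint (R q) X) :
    Wp (add q n U) s fun _ s' => Filled A H K (fun q' => R q' ∪ {o | q' = q ∧ o ∈ X}) h s' ∧
      Frame (N + 18) s s' := by
  refine Wp.bind (wp_tick (Wp.bind (wp_get ?_)))
  dsimp only
  split
  · rename_i V hV
    obtain ⟨T₁, T₂, hT, hset⟩ := Table.set_of_find?_eq_some hV
    have hmem : (q, V) ∈ s.T' := by rw [hT]; simp
    have hVg := hs.table.good _ hmem
    have hVe : listEvents s.ecs V = R q := by
      rw [← hs.events q, GoodTable.tableEvents_eq hs.table.nodup hmem]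
    have hVK := hs.table.tails _ hmem
    have hVh := hs.lower _ hmem
    have hVH := hs.table.heads _ (List.mem_map_of_mem hmem)
    have hlen := hVg.length_le hVK
    have hNV := hN (listMaxStart s.ecs V)
    refine Wp.bind ((wp_listInsert (by exact hs.valid) (by exact hn) (by exact hVg)
      (by rw [hVe]; exact hnX ▸ hdisj) (by exact hnh ▸ hVh) (by exact hVK)
      (by exact hnh ▸ hHK h hH _ hVH hVh)).mono ?_)
    rintro V' s' ⟨hss, hV'g, hV'e, hV'm, hV'K⟩
    have hss' := (Step.tick hs.valid 1).trans hss le_rfl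
    have hs' := hs.step hss'
    have hT' : s'.T' = T₁ ++ (q, V) :: T₂ := hss'.T'.trans hT
    have hmV := hVg.listMaxStart_ext hs.valid hss.ext
    refine Wp.bind (wp_tick (wp_modify ⟨⟨hs'.valid, ?_, fun q' => ?_, ?_⟩,
      hss'.ext, hss'.T, hss'.log, ?_⟩)) <;> simp only [hss'.T', hset]
    · refine GoodTable.replace (hT' ▸ hs'.table) hV'g (hV'm.trans hmV.symm) ?_
      rw [hmV]
      exact hV'K
    · have he := hs'.events q'
      rw [hT', tableEvents_append, tableEvents_cons] at he
      rw [tableEvents_append, tableEvents_cons, ← he, hV'e, hnX]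
      rw [hs.valid.listEvents_ext hss.ext fun n hn => hVg.lt_size hn]
      ext o
      simp only [Set.mem_union, Set.mem_ofPred_eq]
      tauto
    · intro x hx
      have hx' : x ∈ s'.T' ∨ x = (q, V') := by
        rw [hT']
        simp only [List.mem_append, List.mem_cons] at hx ⊢
        tauto
      rcases hx' with hx | rfl
      · exact hs'.lower x hx
      · exact hVh.trans_eq hV'm.symm
    · have := hss'.clock
      simp only at hlen
      omega
  · rename_i hV
    obtain ⟨hnew, hset⟩ := Table.set_of_find?_eq_none hV
    refine Wp.bind (wp_tick (wp_modify ⟨⟨hs.valid, ?_, fun q' => ?_, ?_⟩,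
      .refl _, rfl, rfl, ?_⟩)) <;> simp only [hset]
    · refine hs.table.append hnew hq hU ?_ (hUh.symm ▸ hH) (hUh.symm ▸ hK)
      exact fun x hx => hUh ▸ hs.lower x hx
    · rw [tableEvents_append, tableEvents_cons, hs.events, tableEvents_nil, hUX, Set.union_empty]
    · intro x hx
      rcases List.mem_append.mp hx with hx | hx
      · exact hs.lower x hx
      · rw [List.mem_singleton] at hx
        subst hx
        exact hUh.ge
    · omega

theorem wp_scan (p : Q) (t : Tup) (a : Action) (es : List (Transition Tup Q)) (s : Machine Q) :
    Wp (scan p t a es) s fun r s' =>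
      (∃ k ≤ es.length + 1, s' = { s with clock := s.clock + k }) ∧
      (∀ q, r = some q → ∃ e ∈ es, e.source = p ∧ e.action = a ∧ t ∈ e.pred ∧ e.target = q) ∧
      (r = none → ∀ e ∈ es, ¬ (e.source = p ∧ e.action = a ∧ t ∈ e.pred)) := by
  induction es generalizing s with
  | nil => exact Wp.bind (wp_tick (wp_pure ⟨⟨1, by simp, rfl⟩, by simp, by simp⟩))
  | cons e es ih =>
    refine Wp.bind (wp_tick ?_)
    split_ifs with he
    · refine wp_pure ⟨⟨1, by simp, rfl⟩, ?_, by simp⟩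
      rintro q ⟨⟩
      exact ⟨e, by simp, he.1, he.2.1, he.2.2, rfl⟩
    · refine (ih _).mono ?_
      rintro r _ ⟨⟨k, hk, rfl⟩, h1, h2⟩
      refine ⟨⟨k + 1, by simpa using hk, by simp only [Nat.add_assoc, Nat.add_comm 1 k]⟩,
        fun q hq => ?_, fun hr e' he' => ?_⟩
      · obtain ⟨e', he', h⟩ := h1 q hq
        exact ⟨e', List.mem_cons_of_mem _ he', h⟩
      · rcases List.mem_cons.mp he' with rfl | he'
        · exact he
        · exact h2 hr e' he'

/-- The transition function, which is a function because the automaton is I/O-deterministic. -/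
theorem wp_delta (hA : A.IODeterministic) (p : Q) (t : Tup) (a : Action) (s : Machine Q) :
    Wp (delta A p t a) s fun r s' =>
      (∃ k ≤ A.Δ.card + 1, s' = { s with clock := s.clock + k }) ∧
      ∀ q, (∃ e ∈ A.Δ, e.source = p ∧ e.action = a ∧ t ∈ e.pred ∧ e.target = q) ↔ r = some q := by
  refine (wp_scan p t a A.Δ.toList s).mono ?_
  rintro r s' ⟨h1, h2, h3⟩
  refine ⟨by simpa using h1, fun q => ⟨?_, fun hr => by simpa using h2 q hr⟩⟩
  rintro ⟨e, he, rfl, rfl, het, rfl⟩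
  cases r with
  | none => exact (h3 rfl e (by simpa using he) ⟨rfl, rfl, het⟩).elim
  | some q' =>
    obtain ⟨e', he', hs, ha, het', rfl⟩ := h2 q' rfl
    rw [Finset.mem_toList] at he'
    by_cases hee : e = e'
    · rw [hee]
    · exact (hA e he e' he' hee hs.symm ⟨t, het, het'⟩ ha.symm).elim

theorem moves_eq {t : Tup} {j : ℕ} {p : Q} {O : Set (ℕ × Finset ℕ)} {r r' : Option Q}
    (hr : ∀ q, (∃ e ∈ A.Δ, e.source = p ∧ e.action = .mark ∧ t ∈ e.pred ∧ e.target = q) ↔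
      r = some q)
    (hr' : ∀ q, (∃ e ∈ A.Δ, e.source = p ∧ e.action = .unmark ∧ t ∈ e.pred ∧ e.target = q) ↔
      r' = some q) (q : Q) :
    A.moves t j p O q = {o | r = some q ∧ o ∈ (fun o => (o.1, insert j o.2)) '' O} ∪
      {o | r' = some q ∧ o ∈ O} := by
  ext o
  constructor
  · rintro ⟨e, he, hs, het, hq, o', ho', rfl⟩
    cases ha : e.action
    · exact .inl ⟨(hr q).mp ⟨e, he, hs, ha, het, hq⟩, o', ho', rfl⟩
    · exact .inr ⟨(hr' q).mp ⟨e, he, hs, ha, het, hq⟩, ho'⟩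
  · rintro (⟨h, o', ho', rfl⟩ | ⟨h, ho'⟩)
    · obtain ⟨e, he, hs, ha, het, hq⟩ := (hr q).mpr h
      exact ⟨e, he, hs, het, hq, o', ho', by rw [ha]; rfl⟩
    · obtain ⟨e, he, hs, ha, het, hq⟩ := (hr' q).mpr h
      exact ⟨e, he, hs, het, hq, o, ho', by rw [ha]; rfl⟩

/-- The steps for extending nodes and filling the table are needed only if there are transitions at
all, which is why their number `x` is bounded from below under that condition only. -/
theorem wp_execTrans [DecidableEq Q] (hA : A.IODeterministic)
    (hHK : ∀ h ∈ H, ∀ h' ∈ H, h ≤ h' → h ∈ K h') (hN : ∀ h, (K h).card ≤ N) {x : ℕ}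
    (hx : ∀ e ∈ A.Δ, 2 * N + 39 ≤ x)
    {p : Q} {U : List NodeId} {t : Tup} {j : ℕ} {O : Set (ℕ × Finset ℕ)} {s : Machine Q}
    (hs : Filled A H K R h s) (hU : GoodList s.ecs U) (hUO : listEvents s.ecs U = O)
    (hUh : listMaxStart s.ecs U ≤ h) (hH : listMaxStart s.ecs U ∈ H)
    (hK : TailIn s.ecs (K (listMaxStart s.ecs U)) U)
    (hO : ∀ o ∈ O, o.1 ≤ j ∧ ∀ d ∈ o.2, d < j)
    (hdisj : ∀ q, Disjoint (R q) (A.moves t j p O q)) :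
    Wp (execTrans A p U t j) s fun _ s' =>
      Filled A H K (fun q => R q ∪ A.moves t j p O q) (listMaxStart s.ecs U) s' ∧
      Frame (4 * U.length + 2 * A.Δ.card + 2 + x) s s' := by
  obtain ⟨h', hh'⟩ : ∃ h', listMaxStart s.ecs U = h' := ⟨_, rfl⟩
  rw [hh'] at hUh hH hK ⊢
  replace hs := hs.congr (fun _ => rfl) hUh
  refine Wp.bind ((wp_listMerge hs.valid hU).mono ?_)
  rintro n s₁ ⟨hss₁, hn, hnO, hnh⟩
  rw [hUO] at hnO
  rw [hh'] at hnh
  refine Wp.bind ((wp_delta hA p t .mark s₁).mono ?_)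
  rintro r _ ⟨⟨k, hk, rfl⟩, hr⟩
  have hs₁ := hs.step hss₁
  obtain ⟨s₂, hs₂⟩ : ∃ s₂, s₂ = { s₁ with clock := s₁.clock + k } := ⟨_, rfl⟩
  have hss₂ : Step k s₁ s₂ := hs₂ ▸ Step.tick hss₁.valid k
  have hsx : ∀ q, r = some q → 2 * N + 39 ≤ x := by
    intro q hq
    obtain ⟨e, he, -⟩ := (hr q).mpr hq
    exact hx e he
  -- The second half of the procedure.
  suffices hcont : ∀ s₃, Frame (if r = none then 0 else N + 21) s₂ s₃ →
      Filled A H K (fun q => R q ∪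
        {o | r = some q ∧ o ∈ (fun o => (o.1, insert j o.2)) '' O}) h' s₃ →
      Wp (delta A p t .unmark >>= fun r => match r with
        | some q => add q n U
        | none => pure ()) s₃ fun _ s' =>
          Filled A H K (fun q => R q ∪ A.moves t j p O q) h' s' ∧
          Frame (4 * U.length + 2 * A.Δ.card + 2 + x) s s' by
    rw [← hs₂]
    cases r with
    | none =>
      exact hcont s₂ ⟨.refl _, rfl, rfl, le_rfl⟩ ((hs₁.step hss₂).congr (by simp) le_rfl)
    | some q =>
      have hn₂ := hn.ext hss₂.ext
      have hnO₂ := (hss₁.valid.openEvents_ext hss₂.ext hn.lt_size).trans hnO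
      have hnh₂ := (hss₁.valid.maxStart_ext hss₂.ext hn.lt_size).trans hnh
      refine Wp.bind ((wp_extend hss₂.valid hn₂.lt_size (j := j) (hnO₂ ▸ hO)).mono ?_)
      rintro n' s₃ ⟨hss₃, hn', hn'O, hn'h⟩
      rw [hnO₂] at hn'O
      rw [hnh₂] at hn'h
      have hfill : Filled A H K R h' { s₃ with clock := s₃.clock + 1 } :=
        ((hs₁.step hss₂).step hss₃).step (Step.tick hss₃.valid 1)
      refine Wp.bind (Wp.bind (wp_tick (wp_pure (Wp.bind ((wp_add hHK hN hfill ?_ (.inl hn')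
        (goodList_singleton hn') hn'O ?_ hn'h hn'h hH ?_ ?_).mono ?_)))))
      · obtain ⟨e, he, -, -, -, h⟩ := (hr q).mpr rfl
        exact ⟨e, he, h⟩
      · simpa [listEvents_cons, listEvents_nil] using hn'O
      · simp [TailIn]
      · refine (hdisj q).mono_right ?_
        rintro _ ⟨o, ho, rfl⟩
        obtain ⟨e, he, he₁, he₂, he₃, he₄⟩ := (hr q).mpr rfl
        exact ⟨e, he, he₁, he₃, he₄, o, ho, by rw [he₂]; rfl⟩
      rintro _ s₄ ⟨hfill', hfr⟩
      refine hcont s₄ ((hss₃.frame.trans (Frame.tick 1 _) le_rfl).trans hfr ?_)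
        (hfill'.congr ?_ le_rfl)
      · simp only [reduceCtorEq, if_false]
        omega
      · intro q'
        simp only [Option.some.injEq, eq_comm]
  intro s₃ hfr hfill
  refine Wp.bind ((wp_delta hA p t .unmark s₃).mono ?_)
  rintro r' _ ⟨⟨k', hk', rfl⟩, hr'⟩
  have hsx' : ∀ q, r' = some q → 2 * N + 39 ≤ x := by
    intro q hq
    obtain ⟨e, he, -⟩ := (hr' q).mpr hq
    exact hx e he
  have hss₁₂ := hss₁.trans hss₂ le_rfl
  have hext₃ := hss₁₂.ext.trans hfr.ext
  have hfr₃ := (hss₁₂.frame.trans hfr le_rfl).trans (Frame.tick k' s₃) le_rfl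
  have hfill₃ : Filled A H K _ h' { s₃ with clock := s₃.clock + k' } :=
    hfill.step (Step.tick hfill.valid k')
  have hmv := moves_eq (O := O) (j := j) hr hr'
  have hNle : (if r = none then 0 else N + 21) ≤ x := by
    cases hr0 : r with
    | none => simp
    | some q =>
      have := hsx q hr0
      simp only [reduceCtorEq, if_false]
      omega
  cases r' with
  | none =>
    refine wp_pure ⟨hfill₃.congr (fun q => ?_) le_rfl, hfr₃.trans (Frame.tick 0 _) (by omega)⟩
    rw [hmv q]
    simp
  | some q =>
    have hext₁₃ := hss₂.ext.trans hfr.ext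
    refine (wp_add (X := O) hHK hN hfill₃ ?_ (hn.ext hext₁₃) (hU.ext hs.valid hext₃) ?_ ?_ ?_ ?_
      hH ?_ ?_).mono ?_
    · obtain ⟨e, he, -, -, -, h⟩ := (hr' q).mpr rfl
      exact ⟨e, he, h⟩
    · exact (hss₁.valid.openEvents_ext hext₁₃ hn.lt_size).trans hnO
    · exact (hs.valid.listEvents_ext hext₃ fun n hn => hU.lt_size hn).trans hUO
    · exact (hss₁.valid.maxStart_ext hext₁₃ hn.lt_size).trans hnh
    · exact (hU.listMaxStart_ext hs.valid hext₃).trans hh'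
    · exact hK.ext hs.valid hext₃ hU
    · rw [Set.disjoint_union_left]
      constructor
      · refine (hdisj q).mono_right fun o ho => ?_
        rw [hmv q]
        exact .inr ⟨rfl, ho⟩
      · -- Position `j` is marked in the events on the left only.
        rw [Set.disjoint_left]
        rintro _ ⟨-, o, -, rfl⟩ ho
        exact ((hO _ ho).2 j (Finset.mem_insert_self _ _)).false
    rintro _ s₄ ⟨hfill₄, hfr₄⟩
    refine ⟨hfill₄.congr (fun q' => ?_) le_rfl, hfr₃.trans hfr₄ ?_⟩
    · rw [hmv q', Set.union_assoc]
      simp only [Option.some.injEq, eq_comm]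
    · have := hsx' q rfl
      have : (if r = none then 0 else N + 21) ≤ N + 21 := by split_ifs <;> omega
      omega

/-- The transitions of the keys of `L`, when those of the states in `P` have been executed
before. -/
theorem wp_execAll [DecidableEq Q] (hA : A.IODeterministic)
    (hHK : ∀ h ∈ H, ∀ h' ∈ H, h ≤ h' → h ∈ K h') (hN : ∀ h, (K h).card ≤ N) {x : ℕ}
    (hx : ∀ e ∈ A.Δ, 2 * N + 39 ≤ x) {S : Stream'.Seq Tup} {t : Tup} {j : ℕ} {L : Table Q}
    {P : Set Q} {s : Machine Q}
    (hs : Filled A H K (fun q => {o | ∃ p ∈ P, o ∈ A.moves t j p (A.activeRuns S j p) q}) h s)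
    (hL : GoodTable A s.ecs H K L) (hLP : ∀ p ∈ L.map Prod.fst, p ∉ P)
    (hLh : ∀ y ∈ L, listMaxStart s.ecs y.2 ≤ h)
    (hLe : ∀ y ∈ L, listEvents s.ecs y.2 = A.activeRuns S j y.1) :
    Wp (execAll A t j L) s fun _ s' =>
      (∃ h', Filled A H K (fun q => {o | ∃ p, (p ∈ P ∨ p ∈ L.map Prod.fst) ∧
        o ∈ A.moves t j p (A.activeRuns S j p) q}) h' s') ∧
      Frame (L.length * (4 * N + 2 * A.Δ.card + 7 + x) + 1) s s' := by
  induction L generalizing P s h with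
  | nil =>
    refine wp_tick ⟨⟨h, (hs.step (Step.tick hs.valid 1)).congr (by simp) le_rfl⟩, ?_⟩
    exact (Frame.tick 1 s).trans (Frame.tick 0 _) (by simp)
  | cons y L ih =>
    obtain ⟨p, U⟩ := y
    have hU := hL.good (p, U) (by simp)
    have hK := hL.tails (p, U) (by simp)
    have hlen := hU.length_le hK
    have hNU := hN (listMaxStart s.ecs U)
    simp only at hU hK hlen
    have hp : p ∉ P := hLP p (by simp)
    have hs' : Filled A H K _ h { s with clock := s.clock + 1 } := hs.step (Step.tick hs.valid 1)
    refine Wp.bind (wp_tick (Wp.bind ((wp_execTrans hA hHK hN hx hs' (by exact hU)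
      (hLe (p, U) (by simp)) (hLh (p, U) (by simp)) (hL.heads _ (by simp)) (by exact hK) ?_
      ?_).mono ?_)))
    · exact fun o ho => ⟨(CEA.activeRuns_bound ho).1, fun d hd =>
        ((CEA.activeRuns_bound ho).2 d hd).2⟩
    · intro q
      rw [Set.disjoint_left]
      rintro o ⟨p', hp', ho⟩ ho'
      have hne : p' ≠ p := fun h => hp (h ▸ hp')
      exact Set.disjoint_left.mp (CEA.disjoint_moves hA hne q) ho ho'
    rintro _ s₁ ⟨hfill, hfr⟩
    have hext : Ext s.ecs s₁.ecs := hfr.ext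
    have hgood : ∀ y ∈ L, GoodList s.ecs y.2 := fun y hy => hL.good y (by simp [hy])
    have hnd := List.nodup_cons.mp hL.nodup
    have hso := List.pairwise_cons.mp hL.sorted
    refine (ih (P := insert p P) (hfill.congr (fun q => ?_) le_rfl) (hL.of_cons.ext hs.valid hext)
      ?_ ?_ ?_).mono ?_
    · ext o
      simp only [Set.mem_union, Set.mem_ofPred_eq, Set.mem_insert_iff, exists_eq_or_imp]
      exact or_comm
    · intro p' hp' hmem
      rcases Set.mem_insert_iff.mp hmem with rfl | hmem
      · exact hnd.1 hp'
      · exact hLP p' (List.mem_cons_of_mem _ hp') hmem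
    · intro y hy
      rw [(hgood y hy).listMaxStart_ext hs.valid hext]
      exact hso.1 _ (List.mem_map_of_mem hy)
    · intro y hy
      rw [hs.valid.listEvents_ext hext fun n hn => (hgood y hy).lt_size hn]
      exact hLe y (by simp [hy])
    rintro _ s₂ ⟨⟨h', hfill'⟩, hfr'⟩
    refine ⟨⟨h', hfill'.congr (fun q => ?_) le_rfl⟩,
      ((Frame.tick 1 s).trans hfr le_rfl).trans hfr' ?_⟩
    · ext o
      simp only [Set.mem_ofPred_eq, Set.mem_insert_iff, List.map_cons, List.mem_cons]
      constructor <;> rintro ⟨p', hp', ho⟩ <;> exact ⟨p', by tauto, ho⟩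
    · rw [List.length_cons, Nat.add_one_mul L.length]
      simp only at hNU ⊢
      omega

/-- The invariant of the algorithm, before iteration `n`: the table `T` represents the runs on the
first `n` tuples. -/
structure Invariant [Fintype Q] (A : CEA Tup Q) (S : Stream'.Seq Tup) (n : ℕ) (s : Machine Q) :
    Prop where
  valid : s.ecs.Valid
  events : ∀ q, tableEvents s.ecs s.T q = A.openRuns S n q
  table : ∃ (H : Set ℕ) (K : ℕ → Finset ℕ), GoodTable A s.ecs H K s.T ∧
    (∀ h ∈ H, ∀ h' ∈ H, h ≤ h' → h ∈ K h') ∧ ∀ h, (K h).card ≤ Fintype.card Q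

theorem invariant_init [Fintype Q] (A : CEA Tup Q) (S : Stream'.Seq Tup) :
    Invariant A S 0 { ecs := #[], T := [], T' := [], clock := 0, log := [] } :=
  ⟨valid_empty, fun q => tableEvents_nil q,
    ∅, fun _ => ∅, ⟨by simp, by simp, by simp, by simp, by simp, by simp⟩, by simp, by simp⟩

/-- The keys of a table differ from the initial state and are targets of transitions. -/
theorem GoodTable.length_lt [Fintype Q] [DecidableEq Q] {E : TECS} {T : Table Q}
    (hT : GoodTable A E H K T) : T.length < Fintype.card Q ∧ T.length ≤ A.Δ.card := by
  have hc := List.toFinset_card_of_nodup hT.nodup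
  rw [List.length_map] at hc
  rw [← hc]
  constructor
  · refine (Finset.card_le_card (t := Finset.univ.erase A.q₀) fun p hp => ?_).trans_lt ?_
    · obtain ⟨e, he, rfl⟩ := hT.target p (List.mem_toFinset.mp hp)
      exact Finset.mem_erase.mpr ⟨A.target_ne e he, Finset.mem_univ _⟩
    · exact Finset.card_erase_lt_of_mem (Finset.mem_univ _)
  · refine (Finset.card_le_card (t := A.Δ.image Transition.target) fun p hp => ?_).trans
      Finset.card_image_le
    obtain ⟨e, he, rfl⟩ := hT.target p (List.mem_toFinset.mp hp)
    exact Finset.mem_image_of_mem _ he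

/-- The update. For the lists whose first node is new, that is, has maximum-start `n`, the values
allowed for the other maximum-starts are `n` and the maximum-starts of the first nodes of the old
lists. -/
theorem wp_update [Fintype Q] [DecidableEq Q] (hA : A.IODeterministic) {S : Stream'.Seq Tup}
    {t : Tup} {n : ℕ} (ht : S.get? n = some t) {s : Machine Q} (hs : Invariant A S n s) :
    Wp (update A t n) s fun _ s' => Invariant A S (n + 1) s' ∧ s'.log = s.log ∧
      s'.clock ≤ s.clock + 200 * (Fintype.card Q * A.Δ.card + 1) := by
  classical
  obtain ⟨H₀, K₀, hT₀, hHK₀, hN₀⟩ := hs.table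
  have hlt : ∀ y ∈ s.T, listMaxStart s.ecs y.2 < n := by
    intro y hy
    obtain ⟨n₀, ns, hU⟩ := (hT₀.good y hy).exists_eq_cons
    have hn₀ : n₀ < s.ecs.size := (hT₀.good y hy).lt_size (hU ▸ List.mem_cons_self)
    obtain ⟨o, ho, h1⟩ := hs.valid.exists_start hn₀
    rw [hU, listMaxStart_cons, ← h1]
    have : o ∈ tableEvents s.ecs s.T y.1 := ⟨y.2, hy, n₀, by simp [hU], ho⟩
    rw [hs.events] at this
    exact (CEA.openRuns_bound this).1
  obtain ⟨hlen, hlen'⟩ := hT₀.length_lt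
  let V : List ℕ := s.T.map fun y => listMaxStart s.ecs y.2
  have hV : ∀ h ∈ V, h < n := by
    intro h hh
    obtain ⟨y, hy, rfl⟩ := List.mem_map.mp hh
    exact hlt y hy
  let H : Set ℕ := {h | h = n ∨ h ∈ V}
  let K : ℕ → Finset ℕ := Function.update K₀ n (insert n V.toFinset)
  have hT : GoodTable A s.ecs H K s.T := by
    refine ⟨hT₀.nodup, hT₀.target, hT₀.good, hT₀.sorted, fun h hh => .inr hh, fun y hy => ?_⟩
    rw [show K (listMaxStart s.ecs y.2) = K₀ (listMaxStart s.ecs y.2) from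
      Function.update_of_ne (hlt y hy).ne _ _]
    exact hT₀.tails y hy
  have hHK : ∀ h ∈ H, ∀ h' ∈ H, h ≤ h' → h ∈ K h' := by
    rintro h hh h' (rfl | hh') hle
    · simp only [K, Function.update_self, Finset.mem_insert, List.mem_toFinset]
      exact hh
    · rw [show K h' = K₀ h' from Function.update_of_ne (hV h' hh').ne _ _]
      have hn := hV h' hh'
      rcases hh with rfl | hh
      · omega
      · exact hHK₀ h (hT₀.heads h hh) h' (hT₀.heads h' hh') hle
  have hN : ∀ h, (K h).card ≤ Fintype.card Q := by
    intro h
    by_cases hh : h = n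
    · subst hh
      simp only [K, Function.update_self]
      have h1 := Finset.card_insert_le h V.toFinset
      have h2 := List.toFinset_card_le V
      simp only [V, List.length_map] at h1 h2 ⊢
      omega
    · rw [show K h = K₀ h from Function.update_of_ne hh _ _]
      exact hN₀ h
  let x := if A.Δ.card = 0 then 0 else 2 * Fintype.card Q + 39
  have hx : ∀ e ∈ A.Δ, 2 * Fintype.card Q + 39 ≤ x := by
    intro e he
    simp only [x, if_neg (Finset.card_ne_zero_of_mem he), le_refl]
  refine Wp.bind (wp_tick (Wp.bind (wp_modify (Wp.bind ((wp_newBottom (by exact hs.valid)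
    n).mono ?_)))))
  rintro b s₁ ⟨hss₁, hb, hbO, hbh⟩
  have hext₁ : Ext s.ecs s₁.ecs := hss₁.ext
  have hT'₁ : s₁.T' = [] := hss₁.T'
  have hfill : Filled A H K (fun _ => ∅) n { s₁ with clock := s₁.clock + 1 } := by
    refine ⟨hss₁.valid, ?_, ?_, ?_⟩ <;> simp only [hT'₁]
    · exact ⟨by simp, by simp, by simp, by simp, by simp, by simp⟩
    · exact fun q => tableEvents_nil q
    · simp
  have hbh' : listMaxStart s₁.ecs [b] = n := hbh
  refine Wp.bind (Wp.bind (wp_tick (wp_pure (Wp.bind ((wp_execTrans (O := A.activeRuns S n A.q₀)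
    hA hHK hN hx hfill (goodList_singleton hb) ?_ hbh'.le (by exact .inl hbh') ?_ ?_
    (by simp)).mono ?_)))))
  · rw [CEA.activeRuns_init, listEvents_cons, listEvents_nil, Set.union_empty]
    exact hbO
  · simp [TailIn]
  · exact fun o ho => ⟨(CEA.activeRuns_bound ho).1, fun d hd =>
      ((CEA.activeRuns_bound ho).2 d hd).2⟩
  rintro _ s₂ ⟨hfill₂, hfr₂⟩
  have hext₂ : Ext s.ecs s₂.ecs := hext₁.trans hfr₂.ext
  have hT₂ : s₂.T = s.T := hfr₂.T.trans hss₁.T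
  refine Wp.bind (wp_get (Wp.bind ((wp_execAll (P := {A.q₀}) (S := S) hA hHK hN hx
    (hfill₂.congr (fun q => by simp) (by exact hbh'.ge)) (hT₂ ▸ hT.ext hs.valid hext₂) ?_ ?_
    ?_).mono ?_)))
  · rw [hT₂]
    intro p hp hp'
    obtain ⟨e, he, h⟩ := hT.target p hp
    exact A.target_ne e he (h.trans hp')
  · rw [hT₂]
    intro y hy
    rw [(hT.good y hy).listMaxStart_ext hs.valid hext₂]
    exact (hlt y hy).le
  · rw [hT₂]
    intro y hy
    obtain ⟨e, he, h⟩ := hT.target y.1 (List.mem_map_of_mem hy)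
    rw [hs.valid.listEvents_ext hext₂ fun n hn => (hT.good y hy).lt_size hn,
      CEA.activeRuns_of_ne (h ▸ A.target_ne e he), ← hs.events,
      GoodTable.tableEvents_eq hT.nodup hy]
  rintro _ s₃ ⟨⟨h', hfill₃⟩, hfr₃⟩
  refine Wp.bind (wp_tick (wp_modify ⟨⟨hfill₃.valid, fun q => ?_, H, K, hfill₃.table, hHK, hN⟩,
    ?_, ?_⟩))
  · refine (hfill₃.events q).trans ?_
    rw [CEA.openRuns_succ ht]
    ext o
    constructor
    · rintro ⟨p, -, ho⟩
      exact ⟨p, ho⟩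
    · rintro ⟨p, ho⟩
      refine ⟨p, ?_, ho⟩
      -- A state without active runs is irrelevant.
      by_cases hp : p = A.q₀
      · exact .inl hp
      · right
        obtain ⟨e, -, -, -, -, o', ho', -⟩ := ho
        rw [CEA.activeRuns_of_ne hp, ← hs.events] at ho'
        obtain ⟨U, hU, -⟩ := ho'
        rw [hT₂]
        exact List.mem_map_of_mem hU
  · exact hfr₃.log.trans (hfr₂.log.trans hss₁.log)
  · have h1 := hss₁.clock
    have h2 := hfr₂.clock
    have h3 := hfr₃.clock
    simp only [hT₂, List.length_cons, List.length_nil] at h1 h2 h3 ⊢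
    have hQ : 1 ≤ Fintype.card Q := by omega
    -- `T.length` is at most the number of states and at most the number of transitions.
    have e1 : s.T.length * Fintype.card Q ≤ Fintype.card Q * A.Δ.card := by
      rw [mul_comm]; exact Nat.mul_le_mul_left _ hlen'
    have e2 : s.T.length * A.Δ.card ≤ Fintype.card Q * A.Δ.card :=
      Nat.mul_le_mul_right _ hlen.le
    have e3 : A.Δ.card ≤ Fintype.card Q * A.Δ.card := Nat.le_mul_of_pos_left _ hQ
    have e4 : x ≤ 41 * (Fintype.card Q * A.Δ.card) := by
      simp only [x]
      split_ifs with h0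
      · omega
      · have := Nat.le_mul_of_pos_right (Fintype.card Q) (Nat.pos_of_ne_zero h0)
        omega
    have e5 : s.T.length * x ≤ 2 * (s.T.length * Fintype.card Q) + 39 * s.T.length := by
      have : x ≤ 2 * Fintype.card Q + 39 := by simp only [x]; split_ifs <;> omega
      calc s.T.length * x ≤ s.T.length * (2 * Fintype.card Q + 39) := Nat.mul_le_mul_left _ this
        _ = _ := by ring
    have e6 : s.T.length * (4 * Fintype.card Q + 2 * A.Δ.card + 7 + x) =
        4 * (s.T.length * Fintype.card Q) + 2 * (s.T.length * A.Δ.card) + 7 * s.T.length +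
          s.T.length * x := by ring
    omega

end TableInvariant

/-! ### Delays -/

theorem DelayBounded.mono {f f' : ComplexEvent → ℕ} {d d' : ℕ} (hf : ∀ C, f C ≤ f' C)
    (hd : d ≤ d') {a b : ℕ} {L : List (ComplexEvent × ℕ)} (h : DelayBounded f d a L b) :
    DelayBounded f' d' a L b := by
  induction L generalizing a with
  | nil => exact le_trans h (Nat.add_le_add_left hd a)
  | cons y L ih => exact ⟨h.1.trans (Nat.add_le_add_left (hf _) a), ih h.2⟩

/-- The overheads of two consecutive enumerations add up. -/
theorem DelayBounded.append {f : ComplexEvent → ℕ} {k₁ k₂ a b c : ℕ}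
    {L₁ L₂ : List (ComplexEvent × ℕ)}
    (h₁ : DelayBounded (fun C => k₁ + f C) k₁ a L₁ b)
    (h₂ : DelayBounded (fun C => k₂ + f C) k₂ b L₂ c) :
    DelayBounded (fun C => k₁ + k₂ + f C) (k₁ + k₂) a (L₁ ++ L₂) c := by
  induction L₁ generalizing a with
  | nil =>
    simp only [DelayBounded] at h₁
    cases L₂ with
    | nil =>
      simp only [DelayBounded, List.append_nil] at h₂ ⊢
      omega
    | cons y L₂ =>
      have := h₂.1
      refine ⟨?_, h₂.2.mono (fun C => ?_) ?_⟩ <;> simp only at * <;> omega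
  | cons y L₁ ih =>
    have := h₁.1
    refine ⟨?_, ih h₁.2⟩
    simp only at *
    omega

/-! ### Enumeration -/

theorem ComplexEvent.ext' {C C' : ComplexEvent} (h₁ : C.start = C'.start)
    (h₂ : C.finish = C'.finish) (h₃ : C.data = C'.data) : C = C' := by
  cases C; cases C'
  simp_all

section Enumerate

variable {Q : Type}

theorem enumRounds_bottom {s : Machine Q} {n i x j : ℕ} (hc : s.ecs[n]? = some (.bottom i x))
    {P : List ℕ} (h : i ≤ j ∧ P.toFinset ⊆ Finset.Icc i j) (τ k : ℕ)
    (st : List (NodeId × List ℕ)) :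
    (enumRounds τ j (k + 1) ((n, P) :: st)).run s = (enumRounds τ j k st).run
      { s with
        clock := s.clock + (P.length + 4)
        log := s.log ++ [(⟨i, j, P.toFinset, h.1, h.2⟩, s.clock + (P.length + 4))] } := by
  have e : s.clock + 1 + 1 + (P.length + 2) = s.clock + (P.length + 4) := by omega
  simp [enumRounds, readCell, emit, tick, hc, h, e]

theorem enumRounds_output {s : Machine Q} {n p m x : ℕ} (hc : s.ecs[n]? = some (.output p m x))
    (P : List ℕ) (τ j k : ℕ) (st : List (NodeId × List ℕ)) :
    (enumRounds τ j (k + 1) ((n, P) :: st)).run s =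
      (enumRounds τ j k ((m, p :: P) :: st)).run { s with clock := s.clock + 2 } := by
  simp [enumRounds, readCell, tick, hc, Nat.add_assoc]

theorem enumRounds_union {s : Machine Q} {n l r x : ℕ} (hE : s.ecs.Valid)
    (hc : s.ecs[n]? = some (.union l r x)) (P : List ℕ) (τ j k : ℕ)
    (st : List (NodeId × List ℕ)) :
    (enumRounds τ j (k + 1) ((n, P) :: st)).run s =
      (enumRounds τ j k ((l, P) :: if τ ≤ maxStart s.ecs r then (r, P) :: st else st)).run
        { s with clock := s.clock + 3 } := by
  have hr : s.ecs[r]? = some (s.ecs[r]'(hE.child_lt_size (.right hc))) := by simp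
  have hm := hE.maxStart_eq hr
  rw [hm]
  simp only [enumRounds, readCell, readMax, tick, hc, hr, StateT.run_bind, StateT.run_modify,
    Option.bind_eq_bind, Option.bind_some, StateT.run_get, StateT.run_pure, Nat.add_assoc,
    Option.pure_def]
  split_ifs <;> rfl

/-- A search that ends within `k` rounds has the same result when more rounds are allowed. -/
theorem enumRounds_succ {τ j k : ℕ} {st : List (NodeId × List ℕ)} {s : Machine Q}
    {y : Unit × Machine Q} (h : (enumRounds τ j k st).run s = some y) :
    (enumRounds τ j (k + 1) st).run s = some y := by
  induction k generalizing st s with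
  | zero => simp [enumRounds] at h
  | succ k ih =>
    cases st with
    | nil => exact h
    | cons z st =>
      obtain ⟨n, P⟩ := z
      rw [enumRounds] at h ⊢
      simp only [StateT.run_bind, Option.bind_eq_bind, Option.bind_eq_some_iff] at h ⊢
      obtain ⟨a, ha, b, hb, h⟩ := h
      refine ⟨a, ha, b, hb, ?_⟩
      obtain ⟨c, s'⟩ := b
      cases c with
      | bottom i x =>
        simp only [StateT.run_bind, Option.bind_eq_bind, Option.bind_eq_some_iff] at h ⊢
        obtain ⟨a, ha, h⟩ := h
        exact ⟨a, ha, ih h⟩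
      | output p m x => exact ih h
      | union l r x =>
        simp only [StateT.run_bind, Option.bind_eq_bind, Option.bind_eq_some_iff] at h ⊢
        obtain ⟨a, ha, h⟩ := h
        refine ⟨a, ha, ?_⟩
        split_ifs at h ⊢ <;> exact ih h

theorem enumLoop_run {τ j k : ℕ} {st : List (NodeId × List ℕ)} {s : Machine Q}
    {y : Unit × Machine Q} (h : (enumRounds τ j k st).run s = some y) :
    (enumLoop τ j st).run s = some y := by
  classical
  have hmono : ∀ {k k'} {y : Unit × Machine Q}, k ≤ k' →
      (enumRounds τ j k st).run s = some y → (enumRounds τ j k' st).run s = some y := by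
    intro k k' y hk h
    induction hk with
    | refl => exact h
    | step _ ih => exact enumRounds_succ ih
  have hex : ∃ k, ((enumRounds τ j k st).run s).isSome := ⟨k, by rw [h]; rfl⟩
  change (if h : ∃ k, ((enumRounds τ j k st).run s).isSome then
    (enumRounds τ j (Nat.find h) st).run s else none) = some y
  rw [dif_pos hex]
  obtain ⟨y', hy'⟩ := Option.isSome_iff_exists.mp (Nat.find_spec hex)
  rw [hy', ← hmono (Nat.find_min' hex (by rw [h]; rfl)) hy', h]

/-- The complex events printed below the node `n`, if the positions `P` were collected before. -/
def Printed (E : TECS) (τ j : ℕ) (n : NodeId) (P : List ℕ) (C : ComplexEvent) : Prop :=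
  C.finish = j ∧ ∃ o ∈ openEvents E n, τ ≤ o.1 ∧ C.start = o.1 ∧ C.data = o.2 ∪ P.toFinset

/-- The depth-first search below a node. From a node of output-depth `d`, with `P` the positions
collected so far, `d` union nodes are passed, at `3` steps each, before a non-union node is reached;
below an output node these are at most `3` union nodes again. So between the arrival at a node and
the first output `C` there are at most `3 * d + 11 * (|C.data| - |P|) + 2` steps, and then
`|C.data| + 2` steps for printing. -/
theorem enumRounds_node {E : TECS} (hE : E.Valid) {τ j : ℕ} (n : ℕ) (hn : n < E.size)
    (hτ : τ ≤ maxStart E n) (P : List ℕ) (hP : P.Nodup) (hPj : ∀ p ∈ P, p ≤ j)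
    (hPo : ∀ o ∈ openEvents E n, o.1 ≤ j ∧ (∀ d ∈ o.2, d ≤ j) ∧
      ∀ p ∈ P, o.1 ≤ p ∧ ∀ d ∈ o.2, d < p)
    {d : ℕ} (hd : ODepth E n d) (s : Machine Q) (hs : s.ecs = E) :
    ∃ k C x L b,
      (∀ fuel st, (enumRounds τ j (fuel + k) ((n, P) :: st)).run s =
        (enumRounds τ j fuel st).run { s with clock := b, log := s.log ++ (C, x) :: L }) ∧
      x + 11 * P.length ≤ s.clock + 3 * d + 12 * C.data.card + 4 ∧
      DelayBounded (fun C => 12 * C.data.card + 13) 0 x L b ∧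
      (((C, x) :: L).map Prod.fst).Nodup ∧
      ∀ C', C' ∈ ((C, x) :: L).map Prod.fst ↔ Printed E τ j n P C' := by
  induction n using Nat.strong_induction_on generalizing P d s with
  | _ n ih =>
  obtain ⟨c, hc⟩ : ∃ c, E[n]? = some c := ⟨E[n], by simp⟩
  cases c with
  | bottom i x =>
    have ho := openEvents_of_bottom hc
    have hm := hE.maxStart_eq hc
    have hlab : i = x := by
      obtain ⟨o, ho', h1⟩ := hE.exists_start hn
      rw [ho] at ho'
      rw [hm] at h1
      rw [Set.mem_singleton_iff.mp ho'] at h1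
      exact h1
    have h0 := hPo (i, ∅) (ho ▸ rfl)
    have hcond : i ≤ j ∧ P.toFinset ⊆ Finset.Icc i j := by
      refine ⟨h0.1, fun p hp => ?_⟩
      rw [List.mem_toFinset] at hp
      exact Finset.mem_Icc.mpr ⟨(h0.2.2 p hp).1, hPj p hp⟩
    refine ⟨1, ⟨i, j, P.toFinset, hcond.1, hcond.2⟩, s.clock + (P.length + 4), [], _,
      fun fuel st => enumRounds_bottom (hs ▸ hc) hcond τ fuel st, ?_, le_rfl, by simp, ?_⟩
    · simp only [List.toFinset_card_of_nodup hP]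
      omega
    · intro C'
      rw [Printed, ho]
      simp only [List.map_cons, List.map_nil, List.mem_singleton, Set.mem_singleton_iff,
        exists_eq_left, Finset.empty_union]
      constructor
      · rintro rfl
        refine ⟨rfl, ?_, rfl, rfl⟩
        rw [hm] at hτ
        exact hlab ▸ hτ
      · rintro ⟨h1, -, h2, h3⟩
        exact ComplexEvent.ext' h2 h1 h3
  | output p m x =>
    have hmn := hE.lt n m (.next hc)
    have hms := hE.child_lt_size (.next hc)
    have ho := openEvents_of_output hc
    have hl := hE.labels n p m x hc
    have hmm : maxStart E n = maxStart E m := by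
      unfold maxStart starts
      rw [ho]
      congr 1
      ext i
      constructor
      · rintro ⟨D, o, ho', h⟩
        cases h
        exact ⟨o.2, ho'⟩
      · rintro ⟨D, ho'⟩
        exact ⟨_, _, ho', rfl⟩
    have hPo' : ∀ o ∈ openEvents E m, o.1 ≤ j ∧ (∀ d ∈ insert p o.2, d ≤ j) ∧
        ∀ q ∈ P, o.1 ≤ q ∧ ∀ d ∈ insert p o.2, d < q := by
      intro o ho'
      exact hPo (o.1, insert p o.2) (ho ▸ ⟨o, ho', rfl⟩)
    obtain ⟨o₀, ho₀, -⟩ := hE.exists_start hms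
    have hp := hPo' o₀ ho₀
    have hpP : p ∉ P := fun h => ((hp.2.2 p h).2 p (Finset.mem_insert_self _ _)).false
    obtain ⟨d', hd', hd''⟩ := hE.kBounded m hms
    obtain ⟨k, C, y, L, b, h1, h2, h3, h4, h5⟩ := ih m hmn hms (hmm ▸ hτ) (p :: P)
      (List.nodup_cons.mpr ⟨hpP, hP⟩) (by
        intro q hq
        rcases List.mem_cons.mp hq with rfl | hq
        · exact hp.2.1 q (Finset.mem_insert_self _ _)
        · exact hPj q hq) (by
        intro o ho'
        refine ⟨(hPo' o ho').1, fun d hd => (hPo' o ho').2.1 d (Finset.mem_insert_of_mem hd),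
          fun q hq => ?_⟩
        rcases List.mem_cons.mp hq with rfl | hq
        · exact hl o ho'
        · exact ⟨((hPo' o ho').2.2 q hq).1, fun d hd =>
            ((hPo' o ho').2.2 q hq).2 d (Finset.mem_insert_of_mem hd)⟩)
      hd'' { s with clock := s.clock + 2 } hs
    refine ⟨k + 1, C, y, L, b, fun fuel st => ?_, ?_, h3, h4, fun C' => (h5 C').trans ?_⟩
    · exact (enumRounds_output (hs ▸ hc) P τ j (fuel + k) st).trans (h1 fuel st)
    · simp only [List.length_cons] at h2
      omega
    · rw [Printed, Printed, ho]
      refine and_congr_right fun _ => ?_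
      constructor
      · rintro ⟨o, ho', h6, h7, h8⟩
        refine ⟨_, ⟨o, ho', rfl⟩, h6, h7, ?_⟩
        rw [h8, List.toFinset_cons, Finset.union_insert, Finset.insert_union]
      · rintro ⟨_, ⟨o, ho', rfl⟩, h6, h7, h8⟩
        refine ⟨o, ho', h6, h7, ?_⟩
        rw [h8, List.toFinset_cons, Finset.union_insert, Finset.insert_union]
  | union l r x =>
    subst hs
    have hln := hE.lt n l (.left hc)
    have hls := hE.child_lt_size (.left hc)
    have hrn := hE.lt n r (.right hc)
    have hrs := hE.child_lt_size (.right hc)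
    have ho := openEvents_of_union hc
    have hml := hE.maxStart_left hc
    obtain ⟨d', rfl⟩ : ∃ d', d = d' + 1 := by
      cases hd with
      | zero h => exact (h.2 ⟨l, r, x, hc⟩).elim
      | succ _ _ => exact ⟨_, rfl⟩
    have hdl := hd.of_succ hc
    have hstep := fun k st => enumRounds_union (s := s) hE hc P τ j k st
    obtain ⟨k, C, y, L, b, h1, h2, h3, h4, h5⟩ := ih l hln hls (hml ▸ hτ) P hP hPj
      (fun o ho' => hPo o (ho ▸ .inl ho')) hdl { s with clock := s.clock + 3 } rfl
    by_cases hr : τ ≤ maxStart s.ecs r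
    · obtain ⟨dr, hdr, hdr'⟩ := hE.kBounded r hrs
      obtain ⟨k', C', y', L', b', h1', h2', h3', h4', h5'⟩ := ih r hrn hrs hr P hP hPj
        (fun o ho' => hPo o (ho ▸ .inr ho')) hdr'
        { s with clock := b, log := s.log ++ (C, y) :: L } rfl
      refine ⟨k' + k + 1, C, y, L ++ (C', y') :: L', b', fun fuel st => ?_, ?_, ?_, ?_, ?_⟩
      · have h := hstep (fuel + (k' + k)) st
        rw [if_pos hr] at h
        refine h.trans ?_
        rw [← Nat.add_assoc, h1, h1']
        simp
      · simp only at h2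
        omega
      · have hL' : DelayBounded (fun C => 0 + (12 * C.data.card + 13)) 0 b ((C', y') :: L') b' := by
          refine ⟨?_, h3'.mono (fun C => by omega) le_rfl⟩
          simp only at h2' ⊢
          omega
        exact (DelayBounded.append (h3.mono (fun C => by omega) le_rfl) hL').mono
          (fun C => by omega) le_rfl
      · rw [← List.cons_append, List.map_append, List.nodup_append]
        refine ⟨h4, h4', ?_⟩
        rintro C₁ hC₁ _ hC₂ rfl
        obtain ⟨-, o₁, ho₁, -, hs₁, hd₁⟩ := (h5 C₁).mp hC₁
        obtain ⟨-, o₂, ho₂, -, hs₂, hd₂⟩ := (h5' C₁).mp hC₂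
        -- The positions in `P` can be removed from the printed event again.
        have hdisj : ∀ o ∈ openEvents s.ecs n, Disjoint o.2 P.toFinset := by
          intro o ho'
          rw [Finset.disjoint_left]
          intro q hq hq'
          exact (((hPo o ho').2.2 q (List.mem_toFinset.mp hq')).2 q hq).false
        have hdata : o₁.2 = o₂.2 := by
          have h1 := Finset.union_sdiff_cancel_right (hdisj o₁ (ho ▸ .inl ho₁))
          have h2 := Finset.union_sdiff_cancel_right (hdisj o₂ (ho ▸ .inr ho₂))
          rw [← h1, ← h2, ← hd₁, ← hd₂]
        have heq : o₁ = o₂ := Prod.ext (hs₁.symm.trans hs₂) hdata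
        exact Set.disjoint_left.mp (hE.disjoint n l r x hc) ho₁ (heq ▸ ho₂)
      · intro C₁
        rw [← List.cons_append, List.map_append, List.mem_append, h5, h5', Printed, Printed,
          Printed, ho]
        constructor
        · rintro (⟨h, o, ho', h'⟩ | ⟨h, o, ho', h'⟩)
          · exact ⟨h, o, .inl ho', h'⟩
          · exact ⟨h, o, .inr ho', h'⟩
        · rintro ⟨h, o, ho' | ho', h'⟩
          · exact .inl ⟨h, o, ho', h'⟩
          · exact .inr ⟨h, o, ho', h'⟩
    · refine ⟨k + 1, C, y, L, b, fun fuel st => ?_, ?_, h3, h4, fun C' => (h5 C').trans ?_⟩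
      · have h := hstep (fuel + k) st
        rw [if_neg hr] at h
        exact h.trans (h1 fuel st)
      · simp only at h2
        omega
      · rw [Printed, Printed, ho]
        refine and_congr_right fun _ => ?_
        constructor
        · rintro ⟨o, ho', h'⟩
          exact ⟨o, .inl ho', h'⟩
        · rintro ⟨o, ho' | ho', h'⟩
          · exact ⟨o, ho', h'⟩
          · exact (hr (h'.1.trans (hE.le_maxStart ho'))).elim

theorem wp_enumerate {s : Machine Q} (hE : s.ecs.Valid) {n ε j : ℕ} (hn : n < s.ecs.size)
    (ho : ∀ o ∈ openEvents s.ecs n, o.1 ≤ j ∧ ∀ d ∈ o.2, d ≤ j) :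
    Wp (enumerate n ε j) s fun _ s' => s'.ecs = s.ecs ∧ s'.T = s.T ∧
      ∃ L, s'.log = s.log ++ L ∧ (L.map Prod.fst).Nodup ∧
        (∀ C, C ∈ L.map Prod.fst ↔
          C.finish = j ∧ j - ε ≤ C.start ∧ (C.start, C.data) ∈ openEvents s.ecs n) ∧
        DelayBounded (fun C => 2 + (12 * C.data.card + 13)) 2 s.clock L s'.clock := by
  refine Wp.bind (wp_readMax hE hn ?_)
  split_ifs with hτ
  · obtain ⟨d, hd, hd'⟩ := hE.kBounded n hn
    obtain ⟨k, C, x, L, b, h1, h2, h3, h4, h5⟩ := enumRounds_node hE n hn hτ [] List.nodup_nil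
      (by simp) (fun o ho' => ⟨(ho o ho').1, (ho o ho').2, by simp⟩) hd'
      { s with clock := s.clock + 1 } rfl
    refine ⟨(), _, enumLoop_run (h1 1 []), rfl, rfl, (C, x) :: L, rfl, h4, fun C' => ?_, ?_, ?_⟩
    · rw [h5 C', Printed]
      refine and_congr_right fun _ => ?_
      constructor
      · rintro ⟨o, ho', h6, h7, h8⟩
        rw [List.toFinset_nil, Finset.union_empty] at h8
        rw [h7, h8]
        exact ⟨h6, ho'⟩
      · rintro ⟨h6, h7⟩
        exact ⟨_, h7, h6, rfl, by simp⟩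
    · simp only [List.length_nil] at h2 ⊢
      omega
    · have htick : DelayBounded (fun C : ComplexEvent => 1 + (12 * C.data.card + 13)) 1 b []
          (b + 1) := le_rfl
      have := DelayBounded.append (h3.mono (f' := fun C => 0 + (12 * C.data.card + 13))
        (fun C => by omega) le_rfl) htick
      rw [List.append_nil] at this
      exact this.mono (fun C => by omega) (by omega)
  · have hrun : (enumRounds (j - ε) j 1 []).run { s with clock := s.clock + 1 } =
        some ((), { s with clock := s.clock + 2 }) := rfl
    refine ⟨(), _, enumLoop_run hrun, rfl, rfl, [], by simp, by simp, fun C => ?_, le_rfl⟩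
    simp only [List.map_nil, List.not_mem_nil, false_iff]
    rintro ⟨-, h1, h2⟩
    exact hτ (h1.trans (hE.le_maxStart h2))

end Enumerate

section Output

variable {Tup : Type*} {Q : Type} [DecidableEq Q]

/-- The calls of `merge` between the enumerations for different keys cost at most `4 * B` steps
each, if the lists have length at most `B`. -/
theorem wp_outputKeys (A : CEA Tup Q) {ε j B : ℕ} {T : Table Q} {s : Machine Q}
    (hE : s.ecs.Valid) (hT : ∀ x ∈ T, GoodList s.ecs x.2) (hB : ∀ x ∈ T, x.2.length ≤ B)
    (hdisj : T.Pairwise fun x y => Disjoint (listEvents s.ecs x.2) (listEvents s.ecs y.2))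
    (ho : ∀ x ∈ T, ∀ o ∈ listEvents s.ecs x.2, o.1 ≤ j ∧ ∀ d ∈ o.2, d ≤ j) :
    Wp (outputKeys A ε j T) s fun _ s' => s'.ecs.Valid ∧ Ext s.ecs s'.ecs ∧ s'.T = s.T ∧
      ∃ L, s'.log = s.log ++ L ∧ (L.map Prod.fst).Nodup ∧
        (∀ C, C ∈ L.map Prod.fst ↔ C.finish = j ∧ j - ε ≤ C.start ∧
          ∃ x ∈ T, x.1 ∈ A.F ∧ (C.start, C.data) ∈ listEvents s.ecs x.2) ∧
        DelayBounded (fun C => (T.length * (4 * B + 3) + 1) + (12 * C.data.card + 13))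
          (T.length * (4 * B + 3) + 1) s.clock L s'.clock := by
  induction T generalizing s with
  | nil =>
    exact wp_tick ⟨hE, .refl _, rfl, [], by simp, by simp, by simp, by simp [DelayBounded]⟩
  | cons y T ih =>
    obtain ⟨p, U⟩ := y
    have hU : GoodList s.ecs U := hT (p, U) (by simp)
    have hUB : U.length ≤ B := hB (p, U) (by simp)
    rw [List.pairwise_cons] at hdisj
    have hT' : ∀ x ∈ T, GoodList s.ecs x.2 := fun x hx => hT x (by simp [hx])
    -- The remaining keys, after an enumeration of the list `L₁` of outputs for the key `p`.
    have hcont : ∀ (s₁ : Machine Q) (L₁ : List (ComplexEvent × ℕ)), s₁.ecs.Valid →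
        Ext s.ecs s₁.ecs → s₁.T = s.T → s₁.log = s.log ++ L₁ → (L₁.map Prod.fst).Nodup →
        (∀ C, C ∈ L₁.map Prod.fst ↔ C.finish = j ∧ j - ε ≤ C.start ∧
          p ∈ A.F ∧ (C.start, C.data) ∈ listEvents s.ecs U) →
        DelayBounded (fun C => (4 * B + 3) + (12 * C.data.card + 13)) (4 * B + 3) s.clock L₁
          s₁.clock →
        Wp (outputKeys A ε j T) s₁ fun _ s' => s'.ecs.Valid ∧ Ext s.ecs s'.ecs ∧ s'.T = s.T ∧
          ∃ L, s'.log = s.log ++ L ∧ (L.map Prod.fst).Nodup ∧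
            (∀ C, C ∈ L.map Prod.fst ↔ C.finish = j ∧ j - ε ≤ C.start ∧
              ∃ x ∈ (p, U) :: T, x.1 ∈ A.F ∧ (C.start, C.data) ∈ listEvents s.ecs x.2) ∧
            DelayBounded
              (fun C => (((p, U) :: T).length * (4 * B + 3) + 1) + (12 * C.data.card + 13))
              (((p, U) :: T).length * (4 * B + 3) + 1) s.clock L s'.clock := by
      intro s₁ L₁ hE₁ hext hT₁ hlog hnd hL₁ hdel
      have hev : ∀ x ∈ T, listEvents s₁.ecs x.2 = listEvents s.ecs x.2 := fun x hx =>
        hE.listEvents_ext hext fun n hn => (hT' x hx).lt_size hn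
      refine (ih hE₁ (fun x hx => (hT' x hx).ext hE hext) (fun x hx => hB x (by simp [hx])) ?_
        ?_).mono ?_
      · refine hdisj.2.imp_of_mem fun {x y} hx hy hxy => ?_
        rwa [hev x hx, hev y hy]
      · intro x hx
        rw [hev x hx]
        exact ho x (by simp [hx])
      rintro _ s₂ ⟨hE₂, hext₂, hT₂, L₂, hlog₂, hnd₂, hL₂, hdel₂⟩
      refine ⟨hE₂, hext.trans hext₂, hT₂.trans hT₁, L₁ ++ L₂, ?_, ?_, ?_, ?_⟩
      · rw [hlog₂, hlog, List.append_assoc]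
      · rw [List.map_append, List.nodup_append]
        refine ⟨hnd, hnd₂, ?_⟩
        rintro C hC _ hC' rfl
        obtain ⟨-, -, -, h1⟩ := (hL₁ C).mp hC
        obtain ⟨-, -, x, hx, -, h2⟩ := (hL₂ C).mp hC'
        rw [hev x hx] at h2
        exact Set.disjoint_left.mp (hdisj.1 x hx) h1 h2
      · intro C
        rw [List.map_append, List.mem_append, hL₁, hL₂]
        constructor
        · rintro (⟨h1, h2, h3, h4⟩ | ⟨h1, h2, x, hx, h3, h4⟩)
          · exact ⟨h1, h2, (p, U), by simp, h3, h4⟩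
          · rw [hev x hx] at h4
            exact ⟨h1, h2, x, by simp [hx], h3, h4⟩
        · rintro ⟨h1, h2, x, hx, h3, h4⟩
          rcases List.mem_cons.mp hx with rfl | hx
          · exact .inl ⟨h1, h2, h3, h4⟩
          · exact .inr ⟨h1, h2, x, hx, h3, by rwa [hev x hx]⟩
      · have e : ((p, U) :: T).length * (4 * B + 3) + 1 =
            (4 * B + 3) + (T.length * (4 * B + 3) + 1) := by
          rw [List.length_cons]; ring
        rw [e]
        exact hdel.append hdel₂
    refine Wp.bind (wp_tick ?_)
    split_ifs with hp
    · refine Wp.bind ((wp_listMerge (by exact hE) (by exact hU)).mono ?_)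
      rintro n s₁ ⟨hss, hn, hno, -⟩
      refine Wp.bind ((wp_enumerate hss.valid hn.lt_size ?_).mono ?_)
      · rw [hno]
        exact ho (p, U) (by simp)
      rintro _ s₂ ⟨hE₂, hT₂, L, hlog, hnd, hL, hdel⟩
      refine hcont s₂ L (hE₂ ▸ hss.valid) (hE₂ ▸ hss.ext) (hT₂.trans hss.T) ?_ hnd ?_ ?_
      · rw [hlog, hss.log]
      · intro C
        rw [hL C, hno]
        simp only [hp, true_and]
      · have hpre : DelayBounded (fun C : ComplexEvent => (4 * B + 1) + (12 * C.data.card + 13))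
            (4 * B + 1) s.clock [] s₁.clock := by
          have := hss.clock
          simp only [DelayBounded] at this ⊢
          omega
        exact (hpre.append hdel).mono (fun C => by omega) (by omega)
    · refine hcont _ [] hE (.refl _) rfl (by simp) (by simp) (by simp [hp]) ?_
      simp only [DelayBounded]
      omega

theorem wp_output [Fintype Q] {A : CEA Tup Q} (hA : A.IODeterministic) {S : Stream'.Seq Tup}
    {j : ℕ} (ε : ℕ) {s : Machine Q} (hs : Invariant A S (j + 1) s) :
    Wp (output A ε j) s fun _ s' => Invariant A S (j + 1) s' ∧
      ∃ L, s'.log = s.log ++ L ∧ (L.map Prod.fst).Nodup ∧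
        (∀ C, C ∈ L.map Prod.fst ↔ C ∈ A.semAt S ε j) ∧
        DelayBounded (fun C => 200 * (Fintype.card Q ^ 2 + C.size)) (200 * Fintype.card Q ^ 2)
          s.clock L s'.clock := by
  obtain ⟨H, K, hT, hHK, hN⟩ := hs.table
  have hev : ∀ x ∈ s.T, listEvents s.ecs x.2 = A.openRuns S (j + 1) x.1 := by
    intro x hx
    rw [← GoodTable.tableEvents_eq hT.nodup hx, hs.events]
  refine Wp.bind (wp_get ((wp_outputKeys A (B := Fintype.card Q + 1) hs.valid hT.good ?_ ?_
    ?_).mono ?_))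
  · exact fun x hx => ((hT.good x hx).length_le (hT.tails x hx)).trans
      (Nat.add_le_add_right (hN _) 1)
  · have hnd : s.T.Pairwise fun x y => x.1 ≠ y.1 := List.pairwise_map.mp hT.nodup
    refine hnd.imp_of_mem fun {x y} hx hy hxy => ?_
    rw [hev x hx, hev y hy]
    exact CEA.disjoint_openRuns hA hxy
  · intro x hx o ho
    rw [hev x hx] at ho
    have := CEA.openRuns_bound ho
    exact ⟨by omega, fun d hd => by have := (this.2 d hd).2; omega⟩
  rintro _ s' ⟨hE, hext, hT', L, hlog, hnd, hL, hdel⟩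
  refine ⟨⟨hE, fun q => ?_, H, K, ?_, hHK, hN⟩, L, hlog, hnd, fun C => ?_, hdel.mono ?_ ?_⟩
  · rw [hT', GoodTable.tableEvents_ext hs.valid hext hT.good, hs.events]
  · rw [hT']
    exact hT.ext hs.valid hext
  · rw [hL C, CEA.mem_semAt_iff]
    refine and_congr_right fun _ => and_congr_right fun _ => ?_
    constructor
    · rintro ⟨x, hx, hF, h⟩
      exact ⟨x.1, hF, hev x hx ▸ h⟩
    · rintro ⟨q, hF, h⟩
      rw [← hs.events] at h
      obtain ⟨U, hU, h⟩ := h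
      exact ⟨(q, U), hU, hF, h⟩
  all_goals
    have hlen := hT.length_lt.1
    have h1 : s.T.length * (4 * (Fintype.card Q + 1) + 3) ≤
        4 * Fintype.card Q ^ 2 + 7 * Fintype.card Q := by
      refine (Nat.mul_le_mul_right _ hlen.le).trans_eq ?_
      ring
    have h2 : Fintype.card Q ≤ Fintype.card Q ^ 2 := Nat.le_self_pow (by omega) _
  · intro C
    simp only [ComplexEvent.size]
    omega
  · omega

end Output

/-- The algorithm does not fail and maintains its invariant, as long as there are tuples to read. -/
theorem exists_evaluation {Tup : Type*} {Q : Type} [Fintype Q] [DecidableEq Q] {A : CEA Tup Q}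
    (hA : A.IODeterministic) {S : Stream'.Seq Tup} (ε : ℕ) {n : ℕ}
    (h : ∀ k < n, ∃ t, S.get? k = some t) :
    ∃ s, evaluation A S ε n = some s ∧ Invariant A S n s := by
  induction n with
  | zero => exact ⟨_, rfl, invariant_init A S⟩
  | succ n ih =>
    obtain ⟨s, hs, hinv⟩ := ih fun k hk => h k (by omega)
    obtain ⟨t, ht⟩ := h n (by omega)
    obtain ⟨_, s₁, h1, hinv₁, -⟩ := wp_update hA ht hinv
    obtain ⟨_, s₂, h2, hinv₂, -⟩ := wp_output hA ε hinv₁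
    exact ⟨s₂, by simp [evaluation, hs, ht, h1, h2], hinv₂⟩

end CER

theorem mainTheorem1 :
    ∃ c : ℕ, ∀ (Ty : Type u) (Attr : Type v) (Val : Type w) (Q : Type) [Fintype Q] [DecidableEq Q]
      (A : CER.CEA (CER.DataTuple Ty Attr Val) Q), A.IODeterministic →
      ∀ (S : Stream'.Seq (CER.DataTuple Ty Attr Val)) (ε j : ℕ) (t : CER.DataTuple Ty Attr Val),
        S.get? j = some t →
        -- The `j`-th iteration: state before, after the update, after the call of `Output`.
        ∃ s₀ s₁ s₂ : CER.Machine Q,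
          CER.evaluation A S ε j = some s₀ ∧
          (CER.update A t j).run s₀ = some ((), s₁) ∧
          (CER.output A ε j).run s₁ = some ((), s₂) ∧
          CER.evaluation A S ε (j + 1) = some s₂ ∧
          -- `Output` enumerates the set, without repetition and with output-linear delay.
          (∃ L : List (CER.ComplexEvent × ℕ),
            s₁.log = s₀.log ∧
            s₂.log = s₁.log ++ L ∧
            (L.map Prod.fst).Nodup ∧
            (∀ C, C ∈ L.map Prod.fst ↔ C ∈ A.semAt S ε j) ∧
            CER.DelayBounded (fun C => c * (Fintype.card Q ^ 2 + C.size)) (c * Fintype.card Q ^ 2)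
              s₁.clock L s₂.clock) ∧
          -- The tECS, after the update and after `Output`.
          (∀ E : CER.TECS, E = s₁.ecs ∨ E = s₂.ecs →
            CER.TECS.IsDAG E ∧ CER.TECS.TimeOrdered E ∧ CER.TECS.KBounded 3 E ∧
              CER.TECS.DuplicateFree E) ∧
          -- The union-lists, and their order in the hash table.
          (∀ q U, (q, U) ∈ s₁.T →
            CER.TECS.IsUnionList s₁.ecs U ∧ U.length ≤ Fintype.card Q + 1) ∧
          (s₁.T.Pairwise fun x y =>
            CER.TECS.listMaxStart s₁.ecs y.2 ≤ CER.TECS.listMaxStart s₁.ecs x.2) ∧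
          -- Update time.
          s₁.clock ≤ s₀.clock + c * (Fintype.card Q * A.Δ.card + 1) := by
  refine ⟨200, fun Ty Attr Val Q _ _ A hA S ε j t ht => ?_⟩
  obtain ⟨s₀, h₀, hinv₀⟩ := CER.exists_evaluation hA (S := S) ε (n := j) fun k hk =>
    S.ge_stable hk.le ht
  obtain ⟨_, s₁, h₁, hinv₁, hlog, hclock⟩ := CER.wp_update hA ht hinv₀
  obtain ⟨_, s₂, h₂, hinv₂, L, hlog', hnd, hL, hdel⟩ := CER.wp_output hA ε hinv₁
  obtain ⟨H, K, hT, -, hN⟩ := hinv₁.table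
  refine ⟨s₀, s₁, s₂, h₀, h₁, h₂, by simp [CER.evaluation, h₀, ht, h₁, h₂],
    ⟨L, hlog, hlog', hnd, hL, hdel⟩, ?_, ?_, List.pairwise_map.mp hT.sorted, hclock⟩
  · rintro E (rfl | rfl)
    · exact ⟨hinv₁.valid.isDAG, hinv₁.valid.timeOrdered, hinv₁.valid.kBounded,
        hinv₁.valid.duplicateFree⟩
    · exact ⟨hinv₂.valid.isDAG, hinv₂.valid.timeOrdered, hinv₂.valid.kBounded,
        hinv₂.valid.duplicateFree⟩
  · intro q U hU
    have hg := hT.good (q, U) hU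
    exact ⟨hg.isUnionList, (hg.length_le (hT.tails (q, U) hU)).trans
      (Nat.add_le_add_right (hN _) 1)⟩
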